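/- Let $G$ be a group, let $\overline G$ be a second copy of $G$ with $g\mapsto\overline g$ the identity isomorphism, and in the free product $G*\overline G$ let $\mathcal D=[G,\overline G]$ and let $\mathcal L$ be the subgroup generated by $\{g^{-1}\overline g\mid g\in G\}$. Define $\mathcal E(G)=\langle G,\overline G\mid[\mathcal D,\mathcal L]=1\rangle$, the quotient of $G*\overline G$ by the normal closure of $[\mathcal D,\mathcal L]$. For a finite presentation $\langle X\mid R\rangle$, and a word $w$ in the free group $F(X)$ representing the identity, let $\mathrm{Area}(w)$ be the least $M$ such that $w=\prod_{i=1}^M\theta_i^{-1}r_i\theta_i$ in $F(X)$ for some $\theta_i\in F(X)$ and $r_i\in R\cup R^{-1}$. The Dehn function of the presentation is $\delta(n)=\max\{\mathrm{Area}(w)\mid w=1\text{ in }\langle X\mid R\rangle,\ |w|\le n\}$. For $f,g:\mathbb N\to\mathbb N$ write $f\preceq g$ if there is a positive integer $C$ such that $f(n)\le C\,g(Cn+C)+Cn+C$ for all $n\in\mathbb N$. If $\mathcal E(G)$ is finitely presented, then $G$ is finitely presented, and $$\delta_{\mathcal E(G)}(n)\preceq\max\{n^4,\ \delta_G(n)^2\},$$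 where $\delta_{\mathcal E(G)}$ and $\delta_G$ are the Dehn functions of arbitrary finite presentations of $\mathcal E(G)$ and $G$. -/

import Mathlib

/-- The family `R` of words in the finite alphabet `X`, together with the map `φ` from the free
group on `X` to `G`, is a finite presentation `⟨X ∣ R⟩` of the group `G`. -/
structure IsFinitePresentation {G : Type*} [Group G] {X : Type*}
    (φ : FreeGroup X →* G) (R : Set (FreeGroup X)) : Prop where
  finite_generators : Finite X
  finite_relators : R.Finite
  surjective : Function.Surjective φ
  normalClosure_eq_ker : Subgroup.normalClosure R = φ.ker

/-- The sequence `l = ((θ₁, r₁), …, (θ_M, r_M))` of pairs of words, with all `rᵢ ∈ R ∪ R⁻¹`,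
satisfies `w = ∏ θᵢ⁻¹ rᵢ θᵢ` in the free group on `X`. -/
def IsRelatorExpression {X : Type*} (R : Set (FreeGroup X)) (w : FreeGroup X)
    (l : List (FreeGroup X × FreeGroup X)) : Prop :=
  (∀ p ∈ l, p.2 ∈ R ∨ p.2⁻¹ ∈ R) ∧ w = (l.map fun p => p.1⁻¹ * p.2 * p.1).prod

/-- `Area(w)`: the least number of factors in an expression of `w` as a product of conjugates of
elements of `R ∪ R⁻¹`. It is used only for `w` in the normal closure of `R`. -/
noncomputable def relatorArea {X : Type*} (R : Set (FreeGroup X)) (w : FreeGroup X) : ℕ :=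
  sInf {M : ℕ | ∃ l, IsRelatorExpression R w l ∧ l.length = M}

/-- The areas of the words of length at most `n` that represent the identity in `⟨X ∣ R⟩`. -/
def areaSet {X : Type*} (R : Set (FreeGroup X)) (n : ℕ) : Set ℕ :=
  open Classical in
  {a : ℕ | ∃ w ∈ Subgroup.normalClosure R, w.norm ≤ n ∧ relatorArea R w = a}

/-- The Dehn function `δ(n) = max {Area(w) ∣ w = 1 in ⟨X ∣ R⟩, |w| ≤ n}` of the presentation
`⟨X ∣ R⟩`; the maximum exists when `X` is finite. -/
noncomputable def dehnFunction {X : Type*} (R : Set (FreeGroup X)) (n : ℕ) : ℕ :=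
  sSup (areaSet R n)

/-- A word in the normal closure of `R` has an expression that realizes its area. -/
theorem exists_relatorExpression {X : Type*} (R : Set (FreeGroup X)) (w : FreeGroup X)
    (hw : w ∈ Subgroup.normalClosure R) :
    ∃ l, IsRelatorExpression R w l ∧ l.length = relatorArea R w := by
  refine Nat.sInf_mem (s := {M : ℕ | ∃ l, IsRelatorExpression R w l ∧ l.length = M}) ?_
  suffices h : ∃ l, IsRelatorExpression R w l from ⟨_, h.choose, h.choose_spec, rfl⟩
  refine Subgroup.closure_induction (p := fun w _ => ∃ l, IsRelatorExpression R w l)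
    ?_ ?_ ?_ ?_ hw
  · intro x hx
    obtain ⟨r, hr, hc⟩ := Group.mem_conjugatesOfSet_iff.1 hx
    obtain ⟨c, hc⟩ := isConj_iff.1 hc
    exact ⟨[(c⁻¹, r)], by simp [hr], by simp [hc]⟩
  · exact ⟨[], by simp, by simp⟩
  · rintro x y _ _ ⟨l, hl, rfl⟩ ⟨m, hm, rfl⟩
    refine ⟨l ++ m, ?_, by simp⟩
    intro p hp
    rcases List.mem_append.1 hp with h | h
    exacts [hl p h, hm p h]
  · rintro x _ ⟨l, hl, rfl⟩
    refine ⟨(l.map fun p => (p.1, p.2⁻¹)).reverse, ?_, ?_⟩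
    · intro p hp
      simp only [List.mem_reverse, List.mem_map] at hp
      obtain ⟨q, hq, rfl⟩ := hp
      simpa [or_comm] using hl q hq
    · simp [List.prod_inv_reverse, Function.comp_def, mul_assoc]

/-- Over a finite alphabet the maximum in the definition of the Dehn function exists. -/
theorem isGreatest_dehnFunction {X : Type*} [Finite X] (R : Set (FreeGroup X)) (n : ℕ) :
    IsGreatest (areaSet R n) (dehnFunction R n) := by
  classical
  have hfin : {w : FreeGroup X | w.norm ≤ n}.Finite := by
    refine Set.Finite.of_finite_image ((List.finite_length_le (X × Bool) n).subset ?_)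
      FreeGroup.toWord_injective.injOn
    rintro _ ⟨w, hw, rfl⟩
    exact hw
  have hbdd : (areaSet R n).Finite := by
    refine (hfin.image (relatorArea R)).subset ?_
    rintro a ⟨w, -, hn, rfl⟩
    exact ⟨w, hn, rfl⟩
  have hne : (areaSet R n).Nonempty := ⟨_, 1, one_mem _, by simp, rfl⟩
  exact ⟨Nat.sSup_mem hne hbdd.bddAbove, fun a ha => le_csSup hbdd.bddAbove ha⟩

/-- `f ≼ g`: there is a positive integer `C` with `f(n) ≤ C g(Cn + C) + Cn + C` for all `n`. -/
def DehnLE (f g : ℕ → ℕ) : Prop :=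
  ∃ C : ℕ, 0 < C ∧ ∀ n : ℕ, f n ≤ C * g (C * n + C) + C * n + C

infix:50 " ≼ᵈ " => DehnLE

namespace SidkiE

variable (G : Type*) [Group G]

/-- `𝒟 = [G, Ḡ]` in the free product `G ∗ Ḡ`, where `Ḡ` is a second copy of `G`. -/
def D : Subgroup (Monoid.Coprod G G) :=
  ⁅(Monoid.Coprod.inl : G →* Monoid.Coprod G G).range,
    (Monoid.Coprod.inr : G →* Monoid.Coprod G G).range⁆

/-- `ℒ`, the subgroup of the free product `G ∗ Ḡ` generated by the elements `g⁻¹ ḡ`, `g ∈ G`. -/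
def L : Subgroup (Monoid.Coprod G G) :=
  Subgroup.closure (Set.range fun g : G => (Monoid.Coprod.inl g)⁻¹ * Monoid.Coprod.inr g)

end SidkiE

/-- The group `ℰ(G) = ⟨G, Ḡ ∣ [𝒟, ℒ] = 1⟩`: the quotient of the free product `G ∗ Ḡ` by the normal
closure of `[𝒟, ℒ]`. -/
abbrev SidkiE (G : Type*) [Group G] : Type _ :=
  Monoid.Coprod G G ⧸
    Subgroup.normalClosure ((⁅SidkiE.D G, SidkiE.L G⁆ : Subgroup (Monoid.Coprod G G)) :
      Set (Monoid.Coprod G G))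

/-! The map `toTriple` from $\mathcal E(G)$ to $G^3$, $g\mapsto(g,1,g)$, $\overline
g\mapsto(1,g,g)$, reduces the theorem to a Dehn function estimate in $G^3$. Since $\mathcal D$ is
the kernel of $G*\overline G\to G\times G$ and $\mathcal L$ is the kernel of the folding map onto
$G$, the kernel of `toTriple` is the image of $\mathcal D\cap\mathcal L$. It is abelian because
$[\mathcal D,\mathcal L]=1$, and it is centralized by the images of $\mathcal D$ and $\mathcal L$.

Finite presentability forces $G^{ab}$ to be finite (`SidkiE.finite_abelianization`): a surjection
$G\to\mathbb Z$ yields homomorphisms from $G*\overline G$ to the permutations of $\mathbb Z$, almost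
all of which kill any given finite subset of $[\mathcal D,\mathcal L]$, while none of those with
$k>0$ kills all of it. Consequently the image of `toTriple` has finite index, and every element of
its kernel has finitely many conjugates, as conjugation on the kernel factors through a quotient of
$G^{ab}$.

Let $w$ be a word of length $n$ that is trivial in $\mathcal E(G)$. In $G^3$ it has area $A\preceq
n^2+\delta_G(n)$ (`areaLE_tripleRelators`). Rewriting over the finite-index image
(`exists_transfer_of_finiteIndex`) presents $w$ as a product of $O(A)$ conjugates
$\theta^{-1}r\theta$, with $r$ from a finite set of words representing elements of $\ker$ `toTriple`
and $|\theta|=O(A)$; the length bound is `IsRelatorExpression.exists_norm_le`. In $\mathcal E(G)$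
each conjugate equals one of finitely many commuting words $\zeta_j$, at cost $O(|\theta|)$, hence
$O(A^2)$ in total. The remaining null-homotopic product of $O(A)$ commuting words costs $O(A^2)$
(`exists_areaLE_list_prod_of_commute`). The sum is of order $\max\{n^4,\delta_G(n)^2\}$. -/

/-! ### Contraction of words by cancellations and insertions of relators. -/

section Contraction

variable {X : Type*}

/-- `Contracts 𝓡 w a`: the word `w` can be transformed into the empty word by deletions of pairs
`x x⁻¹` and `a` insertions of words of `𝓡`. -/
inductive Contracts (𝓡 : Set (List (X × Bool))) : List (X × Bool) → ℕ → Prop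
  | nil : Contracts 𝓡 [] 0
  | insert (p q r : List (X × Bool)) (a : ℕ) (hr : r ∈ 𝓡) :
      Contracts 𝓡 (p ++ (r ++ q)) a → Contracts 𝓡 (p ++ q) (a + 1)
  | delete (p q : List (X × Bool)) (x : X) (b : Bool) (a : ℕ) :
      Contracts 𝓡 (p ++ q) a → Contracts 𝓡 (p ++ (x, b) :: (x, !b) :: q) a

/-- `Arises 𝓡 t b`: the word `t` can be obtained from the empty word by deletions of pairs
`x x⁻¹` and `b` insertions of words of `𝓡`. -/
inductive Arises (𝓡 : Set (List (X × Bool))) : List (X × Bool) → ℕ → Prop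
  | nil : Arises 𝓡 [] 0
  | insert (p q r : List (X × Bool)) (b : ℕ) (hr : r ∈ 𝓡) :
      Arises 𝓡 (p ++ q) b → Arises 𝓡 (p ++ (r ++ q)) (b + 1)
  | delete (p q : List (X × Bool)) (x : X) (c : Bool) (b : ℕ) :
      Arises 𝓡 (p ++ (x, c) :: (x, !c) :: q) b → Arises 𝓡 (p ++ q) b

variable {𝓡 : Set (List (X × Bool))}

theorem Arises.insert_arises {t : List (X × Bool)} {b : ℕ} (ht : Arises 𝓡 t b)
    (p q : List (X × Bool)) {a : ℕ} (h : Arises 𝓡 (p ++ q) a) :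
    Arises 𝓡 (p ++ (t ++ q)) (a + b) := by
  induction ht with
  | nil => simpa using h
  | insert p' q' r b hr _ ih =>
    have := Arises.insert (p ++ p') (q' ++ q) r _ hr (by simpa using ih)
    simpa [add_assoc] using this
  | delete p' q' x c b _ ih =>
    have := Arises.delete (p ++ p') (q' ++ q) x c _ (by simpa using ih)
    simpa using this

theorem Contracts.remove_arises {t : List (X × Bool)} {b : ℕ} (ht : Arises 𝓡 t b) :
    ∀ (p q : List (X × Bool)) {a : ℕ}, Contracts 𝓡 (p ++ (t ++ q)) a →
      Contracts 𝓡 (p ++ q) (a + b) := by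
  induction ht with
  | nil => intro p q a h; simpa using h
  | insert p' q' r b hr _ ih =>
    intro p q a h
    have := Contracts.insert (p ++ p') (q' ++ q) r _ hr (by simpa using h)
    have := ih p q (by simpa using this)
    rwa [add_right_comm, add_assoc] at this
  | delete p' q' x c b _ ih =>
    intro p q a h
    have := Contracts.delete (p ++ p') (q' ++ q) x c _ (by simpa using h)
    exact ih p q (by simpa using this)

/-- When a cut falls inside an inserted relator, the rotated relator is inserted instead; this is
why `𝓡` must be closed under cyclic permutation. -/
theorem Arises.rotate (hrot : ∀ r₁ r₂, r₁ ++ r₂ ∈ 𝓡 → r₂ ++ r₁ ∈ 𝓡) {t : List (X × Bool)} {b : ℕ}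
    (ht : Arises 𝓡 t b) : ∀ p q, t = p ++ q → Arises 𝓡 (q ++ p) b := by
  induction ht with
  | nil =>
    intro p q h
    obtain ⟨rfl, rfl⟩ := List.nil_eq_append_iff.1 h
    exact .nil
  | insert p' q' r b hr _ ih =>
    intro p q h
    rcases List.append_eq_append_iff.1 h with ⟨e, rfl, he⟩ | ⟨e, rfl, rfl⟩
    · rcases List.append_eq_append_iff.1 he with ⟨f, rfl, rfl⟩ | ⟨f, rfl, rfl⟩
      · have := ih (p' ++ f) q (by simp)
        have := Arises.insert (q ++ p') f r b hr (by simpa using this)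
        simpa using this
      · have h1 := ih p' q' rfl
        have h2 := Arises.insert [] [] _ 0 (hrot _ _ hr) .nil
        have := h1.insert_arises f e (by simpa using h2)
        simpa [add_comm] using this
    · have := ih p (e ++ q') (by simp)
      have := Arises.insert e (q' ++ p) r b hr (by simpa using this)
      simpa using this
  | delete p' q' x c b _ ih =>
    intro p q h
    rcases List.append_eq_append_iff.1 h with ⟨e, rfl, rfl⟩ | ⟨e, rfl, rfl⟩
    · have := ih (p' ++ (x, c) :: (x, !c) :: e) q (by simp)
      have := Arises.delete (q ++ p') e x c b (by simpa using this)
      simpa using this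
    · have := ih p (e ++ (x, c) :: (x, !c) :: q') (by simp)
      have := Arises.delete e (q' ++ p) x c b (by simpa using this)
      simpa using this

/-- The contraction of $u\,x\,t\,x^{-1}v$ is replayed without the two marked letters. Here $t$
records what has accumulated between them, and $b$ the insertions spent on it. Once a marked letter
is cancelled, what is left of the marked part is, up to rotation, $t$ alone; it is removed at cost
$b$, so no insertion is counted twice. -/
theorem Contracts.cancel_aux (hrot : ∀ r₁ r₂, r₁ ++ r₂ ∈ 𝓡 → r₂ ++ r₁ ∈ 𝓡)
    {w : List (X × Bool)} {a : ℕ} (hw : Contracts 𝓡 w a) (x : X) (c : Bool) :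
    ∀ (u t v : List (X × Bool)) (b : ℕ), w = u ++ (x, c) :: (t ++ (x, !c) :: v) → Arises 𝓡 t b →
      Contracts 𝓡 (u ++ v) (a + b) := by
  induction hw with
  | nil => intro u t v b h; simp at h
  | insert p q r a hr _ ih =>
    intro u t v b h ht
    replace h := List.append_eq_append_iff.1 h
    rcases h with ⟨e, rfl, rfl⟩ | ⟨e, rfl, he⟩
    · have := ih (p ++ (r ++ e)) t v b (by simp) ht
      have := Contracts.insert p (e ++ v) r _ hr (by simpa using this)
      rw [add_right_comm]; simpa using this
    · replace he := List.cons_eq_append_iff.1 he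
      rcases he with ⟨rfl, rfl⟩ | ⟨e, rfl, he⟩
      · have := ih (u ++ r) t v b (by simp) ht
        have := Contracts.insert u v r _ hr (by simpa using this)
        rw [add_right_comm]; simpa using this
      · replace he := List.append_eq_append_iff.1 he
        rcases he with ⟨f, rfl, he⟩ | ⟨f, rfl, rfl⟩
        · replace he := List.cons_eq_append_iff.1 he
          rcases he with ⟨rfl, rfl⟩ | ⟨f, rfl, rfl⟩
          · have := ih u (t ++ r) v (b + 1) (by simp)
              (by simpa using Arises.insert t [] r b hr (by simpa using ht))
            rw [add_right_comm]; simpa [add_assoc] using this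
          · have := ih u t (f ++ (r ++ q)) b (by simp) ht
            have := Contracts.insert (u ++ f) q r _ hr (by simpa using this)
            rw [add_right_comm]; simpa using this
        · have := ih u (e ++ (r ++ f)) v (b + 1) (by simp) (Arises.insert e f r b hr ht)
          rw [add_right_comm]; simpa [add_assoc] using this
  | delete p q y d a hpq ih =>
    intro u t v b h ht
    replace h := List.append_eq_append_iff.1 h
    rcases h with ⟨e, rfl, he⟩ | ⟨e, rfl, he⟩
    · replace he := List.cons_eq_append_iff.1 he
      rcases he with ⟨rfl, he⟩ | ⟨e, rfl, he⟩
      · simp only [List.cons.injEq, Prod.mk.injEq] at he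
        obtain ⟨⟨rfl, rfl⟩, he⟩ := he
        cases t with
        | nil =>
          simp only [List.nil_append, List.cons.injEq] at he
          obtain ⟨-, rfl⟩ := he
          have := Contracts.remove_arises ht p v (by simpa using hpq)
          simpa using this
        | cons z t =>
          simp only [List.cons_append, List.cons.injEq] at he
          obtain ⟨rfl, rfl⟩ := he
          -- The marked $x$ cancels against the first letter of $t=x^{-1}t'$. What remains between
          -- $u$ and $v$ is $t'x^{-1}$, a rotation of $t$.
          have := ht.rotate hrot [_] t rfl
          have := Contracts.remove_arises this p v (by simpa using hpq)
          simpa using this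
      · replace he := List.cons_eq_append_iff.1 he
        rcases he with ⟨rfl, he⟩ | ⟨e, rfl, rfl⟩
        · simp only [List.cons.injEq, Prod.mk.injEq] at he
          obtain ⟨⟨rfl, rfl⟩, rfl⟩ := he
          have := Contracts.remove_arises ht p ((x, !!d) :: v) hpq
          simpa using this
        · have := ih (p ++ e) t v b (by simp) ht
          have := Contracts.delete p (e ++ v) y d _ (by simpa using this)
          simpa using this
    · replace he := List.cons_eq_append_iff.1 he
      rcases he with ⟨rfl, he⟩ | ⟨e, rfl, he⟩
      · simp only [List.cons.injEq, Prod.mk.injEq] at he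
        obtain ⟨⟨rfl, rfl⟩, he⟩ := he
        cases t with
        | nil =>
          simp only [List.nil_append, List.cons.injEq] at he
          obtain ⟨-, rfl⟩ := he
          have := Contracts.remove_arises ht u _ (by simpa using hpq)
          simpa using this
        | cons z t =>
          simp only [List.cons_append, List.cons.injEq] at he
          obtain ⟨rfl, rfl⟩ := he
          have := ht.rotate hrot [_] t rfl
          have := Contracts.remove_arises this u v (by simpa using hpq)
          simpa using this
      · replace he := List.append_eq_append_iff.1 he
        rcases he with ⟨f, rfl, he⟩ | ⟨f, rfl, he⟩
        · replace he := List.cons_eq_append_iff.1 he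
          rcases he with ⟨rfl, he⟩ | ⟨f, rfl, rfl⟩
          · simp only [List.cons.injEq, Prod.mk.injEq] at he
            obtain ⟨⟨rfl, rfl⟩, rfl⟩ := he
            have := Contracts.remove_arises (by simpa using ht) (u ++ [(y, c)]) q
              (by simpa using hpq)
            simpa using this
          · have := ih u t (f ++ q) b (by simp) ht
            have := Contracts.delete (u ++ f) q y d _ (by simpa using this)
            simpa using this
        · replace he := List.cons_eq_append_iff.1 he
          rcases he with ⟨rfl, he⟩ | ⟨f, rfl, he⟩
          · simp only [List.cons.injEq, Prod.mk.injEq] at he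
            obtain ⟨⟨rfl, rfl⟩, rfl⟩ := he
            have := Contracts.remove_arises (by simpa using ht) (u ++ [(x, c)]) q
              (by simpa using hpq)
            simpa using this
          · replace he := List.cons_eq_append_iff.1 he
            rcases he with ⟨rfl, he⟩ | ⟨f, rfl, rfl⟩
            · simp only [List.cons.injEq, Prod.mk.injEq] at he
              obtain ⟨⟨rfl, hc⟩, rfl⟩ := he
              -- The marked $x^{-1}$ cancels against the last letter of $t=e\,x$, leaving the
              -- rotation $x\,e$.
              obtain rfl : c = d := by simpa using hc
              have := ht.rotate hrot e [_] rfl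
              have := Contracts.remove_arises this u v (by simpa using hpq)
              simpa using this
            · have := ih u (e ++ f) v b (by simp) (Arises.delete e f y d b ht)
              simpa using this

theorem Contracts.cancel (hrot : ∀ r₁ r₂, r₁ ++ r₂ ∈ 𝓡 → r₂ ++ r₁ ∈ 𝓡)
    (u v : List (X × Bool)) (x : X) (c : Bool) {a : ℕ}
    (h : Contracts 𝓡 (u ++ (x, c) :: (x, !c) :: v) a) : Contracts 𝓡 (u ++ v) a :=
  h.cancel_aux hrot x c u [] v 0 rfl .nil

end Contraction

/-! ### Bounding the conjugators in a relator expression. -/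

section Radius

variable {X : Type*}

open FreeGroup

theorem Contracts.append {𝓡 : Set (List (X × Bool))} {w v : List (X × Bool)} {a b : ℕ}
    (hw : Contracts 𝓡 w a) (hv : Contracts 𝓡 v b) : Contracts 𝓡 (w ++ v) (a + b) := by
  induction hw with
  | nil => simpa using hv
  | insert p q r a hr _ ih =>
    have := Contracts.insert p (q ++ v) r _ hr (by simpa using ih)
    rw [add_right_comm]; simpa using this
  | delete p q x d a _ ih =>
    have := Contracts.delete p (q ++ v) x d _ (by simpa using ih)
    simpa using this

theorem Contracts.insert_inverse_pair {𝓡 : Set (List (X × Bool))} (l : List (X × Bool)) :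
    ∀ (p q : List (X × Bool)) {a : ℕ}, Contracts 𝓡 (p ++ q) a →
      Contracts 𝓡 (p ++ (l ++ (invRev l ++ q))) a := by
  induction l with
  | nil => intro p q a h; simpa using h
  | cons x l ih =>
    intro p q a h
    obtain ⟨x, b⟩ := x
    have := Contracts.delete p q x b _ h
    have := ih (p ++ [(x, b)]) ((x, !b) :: q) (by simpa using this)
    simpa [invRev] using this

theorem Contracts.red {𝓡 : Set (List (X × Bool))} (hrot : ∀ r₁ r₂, r₁ ++ r₂ ∈ 𝓡 → r₂ ++ r₁ ∈ 𝓡)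
    {w v : List (X × Bool)} (h : Red w v) {a : ℕ} (hw : Contracts 𝓡 w a) : Contracts 𝓡 v a := by
  induction h with
  | refl => exact hw
  | tail _ hs ih =>
    cases hs with
    | not => exact ih.cancel hrot _ _ _ _

/-- The cyclic permutations of the reduced words representing the elements of `R ∪ R⁻¹`. -/
def cyclicRelators [DecidableEq X] (R : Set (FreeGroup X)) : Set (List (X × Bool)) :=
  {r | ∃ s, (s ∈ R ∨ s⁻¹ ∈ R) ∧ r ~r s.toWord}

theorem cyclicRelators_rotate [DecidableEq X] (R : Set (FreeGroup X)) (r₁ r₂ : List (X × Bool))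
    (h : r₁ ++ r₂ ∈ cyclicRelators R) : r₂ ++ r₁ ∈ cyclicRelators R := by
  obtain ⟨s, hs, h⟩ := h
  exact ⟨s, hs, List.isRotated_append.trans h⟩

theorem exists_conj_of_mem_cyclicRelators [DecidableEq X] {R : Set (FreeGroup X)} {K : ℕ}
    (hK : ∀ s ∈ R, s.norm ≤ K) {r : List (X × Bool)} (hr : r ∈ cyclicRelators R) :
    r.length ≤ K ∧ ∃ c s : FreeGroup X, (s ∈ R ∨ s⁻¹ ∈ R) ∧ c.norm ≤ K ∧ mk r = c⁻¹ * s * c := by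
  obtain ⟨s, hs, hr⟩ := hr
  have hsK : s.norm ≤ K := by
    rcases hs with h | h
    · exact hK s h
    · simpa using hK _ h
  refine ⟨by rw [hr.perm.length_eq]; exact hsK, ?_⟩
  obtain ⟨n, hn, rfl⟩ := List.isRotated_iff_mod.1 hr.symm
  refine ⟨mk (s.toWord.take n), s, hs, norm_mk_le.trans ?_, ?_⟩
  · exact (List.length_take_le' _ _).trans hsK
  · rw [List.rotate_eq_drop_append_take hn, ← mul_mk]
    have : mk (s.toWord.take n) * mk (s.toWord.drop n) = s := by
      rw [mul_mk, List.take_append_drop, mk_toWord]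
    nth_rewrite 4 [← this]
    group

/-- A relator expression can be replaced by one with no more factors whose conjugators have
length bounded linearly by the length of the word and the number of factors. -/
theorem IsRelatorExpression.exists_norm_le [DecidableEq X] {R : Set (FreeGroup X)} {K : ℕ}
    (hK : ∀ s ∈ R, s.norm ≤ K) {w : FreeGroup X} {l : List (FreeGroup X × FreeGroup X)}
    (h : IsRelatorExpression R w l) :
    ∃ l', IsRelatorExpression R w l' ∧ l'.length = l.length ∧
      ∀ p ∈ l', p.1.norm ≤ w.norm + K * l.length := by
  -- The unreduced product of the $\theta^{-1}r\theta$ contracts by inserting $r^{-1}$ next to each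
  -- $r$; free reduction to $w$ keeps the number of insertions.
  have h1 : Contracts (cyclicRelators R) w.toWord l.length := by
    have key : ∀ l : List (FreeGroup X × FreeGroup X), (∀ p ∈ l, p.2 ∈ R ∨ p.2⁻¹ ∈ R) →
        ∃ v, mk v = (l.map fun p => p.1⁻¹ * p.2 * p.1).prod ∧
          Contracts (cyclicRelators R) v l.length := by
      intro l
      induction l with
      | nil => exact fun _ => ⟨[], by simp [one_eq_mk], .nil⟩
      | cons p l ih =>
        intro hl
        obtain ⟨v, hv, hc⟩ := ih fun q hq => hl q (List.mem_cons_of_mem _ hq)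
        obtain ⟨θ, r⟩ := p
        refine ⟨invRev θ.toWord ++ (r.toWord ++ θ.toWord) ++ v, ?_, ?_⟩
        · rw [← mul_mk, ← mul_mk, ← mul_mk, ← inv_mk, mk_toWord, mk_toWord, hv]
          simp [mul_assoc]
        · rw [List.length_cons, add_comm]
          refine Contracts.append ?_ hc
          have h0 := Contracts.insert_inverse_pair (invRev θ.toWord) [] []
            (.nil : Contracts (cyclicRelators R) [] 0)
          have h1 := Contracts.insert_inverse_pair r.toWord (invRev θ.toWord) (θ.toWord)
            (by simpa using h0)
          have := Contracts.insert (𝓡 := cyclicRelators R) (invRev θ.toWord ++ r.toWord)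
            θ.toWord (invRev r.toWord) 0
            ⟨r⁻¹, by simpa [or_comm] using hl (θ, r) (by simp), by rw [toWord_inv]⟩
            (by simpa using h1)
          simpa using this
    obtain ⟨v, hv, hc⟩ := key l h.1
    refine hc.red (cyclicRelators_rotate R) ?_
    rw [← h.2] at hv
    rw [← hv, toWord_mk]
    exact reduce.red
  -- Each insertion into $pq$ contributes one conjugate, by the suffix $q$ up to a cyclic shift $c$
  -- with $|c|\le K$. Every insertion lengthens the word by at most $K$, so the conjugators stay
  -- within $|v|+Ka$.
  have key : ∀ {v : List (X × Bool)} {a : ℕ}, Contracts (cyclicRelators R) v a →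
      ∃ l', IsRelatorExpression R (mk v) l' ∧ l'.length = a ∧
        ∀ p ∈ l', p.1.norm ≤ v.length + K * a := by
    intro v a hv
    induction hv with
    | nil => exact ⟨[], ⟨by simp, by simp [one_eq_mk]⟩, rfl, by simp⟩
    | insert p q r a hr _ ih =>
      obtain ⟨l', hl, hlen, hn⟩ := ih
      obtain ⟨hrK, c, s, hs, hc, hrc⟩ := exists_conj_of_mem_cyclicRelators hK hr
      refine ⟨l' ++ [(c * mk q, s⁻¹)], ⟨?_, ?_⟩, by simp [hlen], ?_⟩
      · intro p hp
        rcases List.mem_append.1 hp with h | h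
        · exact hl.1 p h
        · simp only [List.mem_singleton] at h
          subst h
          simpa [or_comm] using hs
      · have := hl.2
        rw [List.map_append, List.prod_append, ← this, ← mul_mk, ← mul_mk, ← mul_mk, hrc]
        simp [mul_assoc, -mul_mk, -inv_mk]
      · intro x hx
        rcases List.mem_append.1 hx with h | h
        · have := hn x h
          simp only [List.length_append] at this ⊢
          linarith
        · simp only [List.mem_singleton] at h
          subst h
          have h1 := norm_mul_le c (mk q)
          have h2 : (mk q).norm ≤ q.length := norm_mk_le
          have : K * (a + 1) = K * a + K := by ring
          simp only [List.length_append]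
          have := Nat.zero_le (K * a)
          linarith
    | delete p q x b a _ ih =>
      obtain ⟨l', hl, hlen, hn⟩ := ih
      refine ⟨l', ⟨hl.1, ?_⟩, hlen, ?_⟩
      · rw [← hl.2]
        exact Quot.sound Red.Step.not
      · intro y hy
        have := hn y hy
        simp only [List.length_append, List.length_cons] at this ⊢
        linarith
  obtain ⟨l', hl, hlen, hn⟩ := key h1
  rw [mk_toWord] at hl
  exact ⟨l', hl, hlen, hn⟩

end Radius

/-! ### Calculus of area bounds. -/

section Area

open FreeGroup

variable {X : Type*}

/-- The word `w` is a product of at most `M` conjugates of elements of `R ∪ R⁻¹`. -/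
def AreaLE (R : Set (FreeGroup X)) (w : FreeGroup X) (M : ℕ) : Prop :=
  ∃ l, IsRelatorExpression R w l ∧ l.length ≤ M

variable {R : Set (FreeGroup X)}

theorem IsRelatorExpression.append {u v : FreeGroup X} {l m : List (FreeGroup X × FreeGroup X)}
    (hl : IsRelatorExpression R u l) (hm : IsRelatorExpression R v m) :
    IsRelatorExpression R (u * v) (l ++ m) := by
  refine ⟨fun p hp => ?_, by rw [hl.2, hm.2]; simp⟩
  rcases List.mem_append.1 hp with h | h
  exacts [hl.1 p h, hm.1 p h]

theorem IsRelatorExpression.mem_normalClosure {w : FreeGroup X}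
    {l : List (FreeGroup X × FreeGroup X)} (h : IsRelatorExpression R w l) :
    w ∈ Subgroup.normalClosure R := by
  rw [h.2]
  refine Subgroup.list_prod_mem _ fun x hx => ?_
  obtain ⟨p, hp, rfl⟩ := List.mem_map.1 hx
  have hp2 : p.2 ∈ Subgroup.normalClosure R := by
    rcases h.1 p hp with h | h
    · exact Subgroup.subset_normalClosure h
    · simpa using Subgroup.subset_normalClosure h
  simpa using (inferInstance : (Subgroup.normalClosure R).Normal).conj_mem _ hp2 p.1⁻¹

theorem AreaLE.mem {w : FreeGroup X} {M : ℕ} (h : AreaLE R w M) :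
    w ∈ Subgroup.normalClosure R :=
  h.choose_spec.1.mem_normalClosure

theorem AreaLE.mono {w : FreeGroup X} {M N : ℕ} (h : AreaLE R w M) (hMN : M ≤ N) :
    AreaLE R w N := by
  obtain ⟨l, hl, hM⟩ := h
  exact ⟨l, hl, hM.trans hMN⟩

theorem AreaLE.one : AreaLE R 1 0 := ⟨[], ⟨by simp, by simp⟩, le_rfl⟩

theorem AreaLE.mul {u v : FreeGroup X} {M N : ℕ} (hu : AreaLE R u M) (hv : AreaLE R v N) :
    AreaLE R (u * v) (M + N) := by
  obtain ⟨l, hl, hM⟩ := hu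
  obtain ⟨m, hm, hN⟩ := hv
  exact ⟨l ++ m, hl.append hm, by simp; omega⟩

theorem AreaLE.inv {u : FreeGroup X} {M : ℕ} (hu : AreaLE R u M) : AreaLE R u⁻¹ M := by
  obtain ⟨l, hl, hM⟩ := hu
  refine ⟨(l.map fun p => (p.1, p.2⁻¹)).reverse, ⟨?_, ?_⟩, by simpa⟩
  · intro p hp
    simp only [List.mem_reverse, List.mem_map] at hp
    obtain ⟨q, hq, rfl⟩ := hp
    simpa [or_comm] using hl.1 q hq
  · rw [hl.2]
    simp [List.prod_inv_reverse, Function.comp_def, mul_assoc]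

theorem AreaLE.conj {u : FreeGroup X} {M : ℕ} (hu : AreaLE R u M) (c : FreeGroup X) :
    AreaLE R (c⁻¹ * u * c) M := by
  obtain ⟨l, hl, hM⟩ := hu
  refine ⟨l.map fun p => (p.1 * c, p.2), ⟨?_, ?_⟩, by simpa⟩
  · intro p hp
    obtain ⟨q, hq, rfl⟩ := List.mem_map.1 hp
    exact hl.1 q hq
  · rw [hl.2]
    clear hl hM
    induction l with
    | nil => simp
    | cons p l ih =>
      rw [List.map_cons, List.map_cons, List.map_cons, List.prod_cons, List.prod_cons, ← ih]
      group

theorem AreaLE.of_mem {w : FreeGroup X} (hw : w ∈ Subgroup.normalClosure R) :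
    AreaLE R w (relatorArea R w) := by
  obtain ⟨l, hl, h⟩ := exists_relatorExpression R w hw
  exact ⟨l, hl, h.le⟩

theorem AreaLE.of_mem_relators {w : FreeGroup X} (hw : w ∈ R) : AreaLE R w 1 :=
  ⟨[(1, w)], ⟨by simp [hw], by simp⟩, le_rfl⟩

theorem AreaLE.relatorArea_le {w : FreeGroup X} {M : ℕ} (h : AreaLE R w M) :
    relatorArea R w ≤ M := by
  obtain ⟨l, hl, hM⟩ := h
  have : l.length ∈ {M : ℕ | ∃ l, IsRelatorExpression R w l ∧ l.length = M} := ⟨l, hl, rfl⟩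
  exact (Nat.sInf_le this).trans hM

theorem AreaLE.le_dehnFunction [Finite X] [DecidableEq X] {w : FreeGroup X} {n : ℕ}
    (hw : w ∈ Subgroup.normalClosure R) (hn : w.norm ≤ n) : AreaLE R w (dehnFunction R n) := by
  refine (AreaLE.of_mem hw).mono ((isGreatest_dehnFunction R n).2 ⟨w, hw, ?_, rfl⟩)
  convert hn

theorem exists_areaLE_of_finite {s : Set (FreeGroup X)} (hs : s.Finite)
    (h : s ⊆ Subgroup.normalClosure R) : ∃ C, ∀ w ∈ s, AreaLE R w C := by
  obtain ⟨C, hC⟩ := (hs.image (relatorArea R)).bddAbove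
  exact ⟨C, fun w hw => (AreaLE.of_mem (h hw)).mono (hC ⟨w, hw, rfl⟩)⟩

/-- The words `u` and `v` differ by at most `M` applications of relators. -/
def AreaEq (R : Set (FreeGroup X)) (u v : FreeGroup X) (M : ℕ) : Prop := AreaLE R (u * v⁻¹) M

theorem AreaEq.refl (u : FreeGroup X) : AreaEq R u u 0 := by simpa [AreaEq] using AreaLE.one

theorem AreaEq.mono {u v : FreeGroup X} {M N : ℕ} (h : AreaEq R u v M) (hMN : M ≤ N) :
    AreaEq R u v N := AreaLE.mono h hMN

theorem AreaEq.symm {u v : FreeGroup X} {M : ℕ} (h : AreaEq R u v M) : AreaEq R v u M := by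
  simpa [AreaEq] using AreaLE.inv h

theorem AreaEq.trans {u v w : FreeGroup X} {M N : ℕ} (h : AreaEq R u v M) (h' : AreaEq R v w N) :
    AreaEq R u w (M + N) := by
  simpa [AreaEq] using AreaLE.mul h h'

theorem AreaEq.mul_right {u v : FreeGroup X} {M : ℕ} (h : AreaEq R u v M) (c : FreeGroup X) :
    AreaEq R (u * c) (v * c) M := by
  simpa [AreaEq] using h

theorem AreaEq.mul_left {u v : FreeGroup X} {M : ℕ} (h : AreaEq R u v M) (c : FreeGroup X) :
    AreaEq R (c * u) (c * v) M := by
  simpa [AreaEq, mul_assoc] using AreaLE.conj h c⁻¹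

theorem AreaEq.mul {u v u' v' : FreeGroup X} {M N : ℕ} (h : AreaEq R u v M)
    (h' : AreaEq R u' v' N) : AreaEq R (u * u') (v * v') (M + N) :=
  (h.mul_right u').trans (h'.mul_left v)

theorem AreaEq.conj {u v : FreeGroup X} {M : ℕ} (h : AreaEq R u v M) (c : FreeGroup X) :
    AreaEq R (c⁻¹ * u * c) (c⁻¹ * v * c) M :=
  (h.mul_left c⁻¹).mul_right c

theorem AreaEq.areaLE {u v : FreeGroup X} {M N : ℕ} (h : AreaEq R u v M) (hv : AreaLE R v N) :
    AreaLE R u (M + N) := by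
  simpa using AreaLE.mul h hv

theorem AreaEq.mem_iff {u v : FreeGroup X} {M : ℕ} (h : AreaEq R u v M) :
    u ∈ Subgroup.normalClosure R ↔ v ∈ Subgroup.normalClosure R :=
  ⟨fun hu => (h.symm.areaLE (AreaLE.of_mem hu)).mem, fun hv => (h.areaLE (AreaLE.of_mem hv)).mem⟩

end Area

/-! ### Commuting words with finitely many conjugates. -/

section Commuting

open FreeGroup

variable {X ι : Type*} {R : Set (FreeGroup X)} {ζ : ι → FreeGroup X}

theorem areaEq_list_prod_mul_comm {C : ℕ} {i : ι} (hC : ∀ j, AreaEq R (ζ j * ζ i) (ζ i * ζ j) C)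
    (l : List ι) :
    AreaEq R ((l.map ζ).prod * ζ i) (ζ i * (l.map ζ).prod) (C * l.length) := by
  induction l with
  | nil => simpa using AreaEq.refl _
  | cons j l ih =>
    have := (ih.mul_left (ζ j)).trans (by simpa [mul_assoc] using (hC j).mul_right (l.map ζ).prod)
    simpa [mul_assoc, mul_add] using this

/-- The entries of `l₁` are pulled to the front one at a time, each past at most `l.length` others.
The rest is not sorted, which keeps the cost linear in `l.length` for bounded `l₁`. -/
theorem areaEq_of_perm_append {C : ℕ} (hC : ∀ i j, AreaEq R (ζ j * ζ i) (ζ i * ζ j) C)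
    (l₁ : List ι) : ∀ {l l₂ : List ι}, l.Perm (l₁ ++ l₂) → ∃ l₃ : List ι, l₃.Perm l₂ ∧
      AreaEq R (l.map ζ).prod ((l₁.map ζ).prod * (l₃.map ζ).prod) (C * l₁.length * l.length) := by
  induction l₁ with
  | nil => exact fun {l l₂} h => ⟨l, h, by simpa using AreaEq.refl _⟩
  | cons i l₁ ih =>
    intro l l₂ h
    obtain ⟨a, b, rfl⟩ := List.append_of_mem (a := i) (h.mem_iff.2 (by simp : i ∈ i :: l₁ ++ l₂))
    have h' : (a ++ b).Perm (l₁ ++ l₂) := (List.perm_middle.symm.trans h).cons_inv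
    obtain ⟨l₃, h₃, hA⟩ := ih h'
    refine ⟨l₃, h₃, ?_⟩
    have h1 := (areaEq_list_prod_mul_comm (hC i) a).mul_right (b.map ζ).prod
    have h2 := hA.mul_left (ζ i)
    have h3 := h1.trans (by simpa [mul_assoc] using h2)
    have h4 : C * a.length + C * l₁.length * (a ++ b).length ≤
        C * (i :: l₁).length * (a ++ i :: b).length := by
      simp only [List.length_cons, List.length_append]
      nlinarith [Nat.zero_le C, Nat.zero_le (C * b.length), Nat.zero_le (C * l₁.length)]
    have h5 := h3.mono (by simpa [mul_assoc] using h4)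
    simpa [mul_assoc] using h5

/-- Pairwise commuting words generate an abelian group with quadratic Dehn function: a product of
`n` of them that represents the identity has area at most `C n²`. -/
theorem exists_areaLE_list_prod_of_commute [Finite ι]
    (hcomm : ∀ i j, ζ j * ζ i * (ζ i * ζ j)⁻¹ ∈ Subgroup.normalClosure R) :
    ∃ C, ∀ l : List ι, (l.map ζ).prod ∈ Subgroup.normalClosure R →
      AreaLE R (l.map ζ).prod (C * l.length ^ 2) := by
  classical
  obtain ⟨C₀, hC₀⟩ := exists_areaLE_of_finite
    (Set.finite_range fun p : ι × ι => ζ p.2 * ζ p.1 * (ζ p.1 * ζ p.2)⁻¹)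
    (by rintro _ ⟨p, rfl⟩; exact hcomm _ _)
  have hC₀' : ∀ i j, AreaEq R (ζ j * ζ i) (ζ i * ζ j) C₀ := fun i j => hC₀ _ ⟨(i, j), rfl⟩
  have hsplit : ∀ {l l₁ l₂ : List ι}, l.Perm (l₁ ++ l₂) → ∃ l₃ : List ι, l₃.Perm l₂ ∧
      AreaEq R (l.map ζ).prod ((l₁.map ζ).prod * (l₃.map ζ).prod)
        (C₀ * l₁.length * l.length) := fun {l l₁ l₂} h => areaEq_of_perm_append hC₀' l₁ h
  have hperm : ∀ {l l' : List ι}, l.Perm l' → ((l.map ζ).prod ∈ Subgroup.normalClosure R ↔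
      (l'.map ζ).prod ∈ Subgroup.normalClosure R) := by
    intro l l' h
    obtain ⟨l₃, h₃, hA⟩ := hsplit (l₂ := []) (by simpa using h)
    obtain rfl := List.perm_nil.1 h₃
    simpa using hA.mem_iff
  have hperm2 : ∀ {l l₁ l₂ : List ι}, l.Perm (l₁ ++ l₂) →
      ((l.map ζ).prod ∈ Subgroup.normalClosure R ↔
      (l₁.map ζ).prod * (l₂.map ζ).prod ∈ Subgroup.normalClosure R) := by
    intro l l₁ l₂ h
    rw [hperm h]; simp
  -- Modulo $R$ the product depends only on the multiset of indices. The multisets with trivial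
  -- product form a submonoid closed under subtraction, which is finitely generated by Dickson's
  -- lemma.
  let P : AddSubmonoid (Multiset ι) :=
    { carrier := {m | (m.toList.map ζ).prod ∈ Subgroup.normalClosure R}
      zero_mem' := by simp
      add_mem' := by
        intro a b ha hb
        refine (hperm2 (l₁ := a.toList) (l₂ := b.toList) ?_).2 (mul_mem ha hb)
        rw [← Multiset.coe_eq_coe]
        simp [← Multiset.coe_add] }
  have : WellQuasiOrderedLE (Multiset ι) :=
    Finsupp.orderIsoMultiset.wellQuasiOrderedLE_iff.1 inferInstance
  obtain ⟨S, hS⟩ : P.FG := by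
    refine AddSubmonoid.fg_of_subtractive fun a ha b hab => ?_
    have := (hperm2 (l := (a + b).toList) (l₁ := a.toList) (l₂ := b.toList) (by
        rw [← Multiset.coe_eq_coe]
        simp [← Multiset.coe_add])).1 hab
    exact (Subgroup.mul_mem_cancel_left _ ha).1 this
  obtain ⟨C₁, hC₁⟩ := exists_areaLE_of_finite (R := R)
    (S.finite_toSet.image fun m : Multiset ι => (m.toList.map ζ).prod) (by
      rintro _ ⟨m, hm, rfl⟩
      have : m ∈ P := hS ▸ AddSubmonoid.subset_closure hm
      exact this)
  obtain ⟨k, hk⟩ := (S.finite_toSet.image Multiset.card).bddAbove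
  have hmin : ∀ m ∈ P, m = 0 ∨ ∃ s ∈ S, s ≠ 0 ∧ s ≤ m := by
    intro m hm
    rw [← hS] at hm
    induction hm using AddSubmonoid.closure_induction with
    | mem x hx =>
      by_cases h : x = 0
      · exact .inl h
      · exact .inr ⟨x, hx, h, le_rfl⟩
    | zero => exact .inl rfl
    | add x y _ _ hx hy =>
      rcases hx with rfl | ⟨s, hs, h0, hle⟩
      · simpa using hy
      · exact .inr ⟨s, hs, h0, hle.trans (by simp)⟩
  refine ⟨C₀ * k + C₁, ?_⟩
  suffices H : ∀ n, ∀ l : List ι, l.length ≤ n → (l.map ζ).prod ∈ Subgroup.normalClosure R →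
      AreaLE R (l.map ζ).prod ((C₀ * k + C₁) * l.length ^ 2) from fun l => H _ l le_rfl
  intro n
  induction n with
  | zero =>
    intro l hl _
    obtain rfl : l = [] := by simpa using hl
    simpa using AreaLE.one
  | succ n ih =>
    intro l hl hmem
    have hlP : (l : Multiset ι) ∈ P := by
      refine (hperm (l' := l) ?_).2 hmem
      rw [← Multiset.coe_eq_coe]; simp
    rcases hmin _ hlP with h0 | ⟨s, hs, hs0, hle⟩
    · obtain rfl : l = [] := by simpa using h0
      simpa using AreaLE.one
    · obtain ⟨t, ht⟩ := Multiset.le_iff_exists_add.1 hle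
      -- A nonzero generator $s\le l$ is split off at linear cost and erased at cost `C₁`. Each
      -- round shortens the list, so there are at most `l.length` rounds.
      obtain ⟨l₃, h₃, hA⟩ := hsplit (l := l) (l₁ := s.toList) (l₂ := t.toList) (by
        rw [← Multiset.coe_eq_coe, ht]
        simp [← Multiset.coe_add])
      have hsA := hC₁ _ ⟨s, hs, rfl⟩
      have h₃mem : (l₃.map ζ).prod ∈ Subgroup.normalClosure R :=
        (Subgroup.mul_mem_cancel_left _ hsA.mem).1 (hA.mem_iff.1 hmem)
      have hcard : s.card + l₃.length = l.length := by
        have := congrArg Multiset.card ht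
        rw [h₃.length_eq]; simpa using this.symm
      have hs1 : 0 < s.card := Multiset.card_pos.2 hs0
      have hsk : s.card ≤ k := hk ⟨s, hs, rfl⟩
      refine (hA.areaLE (hsA.mul (ih l₃ (by omega) h₃mem))).mono ?_
      rw [Multiset.length_toList]
      have h1 : l₃.length + 1 ≤ l.length := by omega
      have h2 : C₀ * s.card * l.length ≤ C₀ * k * l.length := by gcongr
      have h3 : l.length + l₃.length ^ 2 ≤ l.length ^ 2 := by nlinarith
      have h4 : C₁ ≤ C₁ * l.length := Nat.le_mul_of_pos_right _ (by omega)
      calc _ ≤ C₀ * k * l.length + (C₁ * l.length + (C₀ * k + C₁) * l₃.length ^ 2) := by gcongr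
        _ = (C₀ * k + C₁) * (l.length + l₃.length ^ 2) := by ring
        _ ≤ _ := by gcongr

/-- Conjugation by a single letter sends each $\zeta_i$ to some $\zeta_j$ at bounded cost, as there
are finitely many pairs; the letters of $\theta$ are absorbed one by one. -/
theorem exists_areaEq_conj [Finite X] [DecidableEq X] [Finite ι]
    (hconj : ∀ (θ : FreeGroup X) (i : ι),
      ∃ j, θ⁻¹ * ζ i * θ * (ζ j)⁻¹ ∈ Subgroup.normalClosure R) :
    ∃ C, ∀ (θ : FreeGroup X) (i : ι), ∃ j, AreaEq R (θ⁻¹ * ζ i * θ) (ζ j) (C * θ.norm) := by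
  choose σ hσ using hconj
  obtain ⟨C, hC⟩ := exists_areaLE_of_finite
    (Set.finite_range fun p : (X × Bool) × ι =>
      (mk [p.1])⁻¹ * ζ p.2 * mk [p.1] * (ζ (σ (mk [p.1]) p.2))⁻¹)
    (by rintro _ ⟨p, rfl⟩; exact hσ _ _)
  refine ⟨C, fun θ => ?_⟩
  suffices H : ∀ (L : List (X × Bool)) (i : ι),
      ∃ j, AreaEq R ((mk L)⁻¹ * ζ i * mk L) (ζ j) (C * L.length) by
    have := H θ.toWord
    rwa [mk_toWord] at this
  intro L
  induction L with
  | nil => exact fun i => ⟨i, by simpa [← one_eq_mk] using AreaEq.refl _⟩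
  | cons x L ih =>
    intro i
    obtain ⟨j, hj⟩ := ih (σ (mk [x]) i)
    refine ⟨j, ?_⟩
    have h1 : AreaEq R ((mk [x])⁻¹ * ζ i * mk [x]) (ζ (σ (mk [x]) i)) C := hC _ ⟨(x, i), rfl⟩
    have h2 := (h1.conj (mk L)).trans hj
    have h3 : mk (x :: L) = mk [x] * mk L := by rw [mul_mk]; rfl
    rw [h3, List.length_cons]
    have h4 : (mk [x] * mk L)⁻¹ * ζ i * (mk [x] * mk L) =
        (mk L)⁻¹ * ((mk [x])⁻¹ * ζ i * mk [x]) * mk L := by group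
    rw [h4]
    exact h2.mono (by ring_nf; rfl)

/-- Suppose the finitely many words `ζ i` commute and are permuted by conjugation modulo the
relators `R`, and that each word of `T ∪ T⁻¹` equals some `ζ i`. A null-homotopic word that is a
product of `A` conjugates of elements of `T ∪ T⁻¹` by words of length at most `A` has area at most
`C A (A + 1)`. -/
theorem exists_areaLE_of_conj_closed [Finite X] [DecidableEq X] [Finite ι]
    (hcomm : ∀ i j, ζ j * ζ i * (ζ i * ζ j)⁻¹ ∈ Subgroup.normalClosure R)
    (hconj : ∀ (θ : FreeGroup X) (i : ι),
      ∃ j, θ⁻¹ * ζ i * θ * (ζ j)⁻¹ ∈ Subgroup.normalClosure R)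
    {T : Set (FreeGroup X)} (hT : T.Finite)
    (hTζ : ∀ r, r ∈ T ∨ r⁻¹ ∈ T → ∃ i, r * (ζ i)⁻¹ ∈ Subgroup.normalClosure R) :
    ∃ C, ∀ w ∈ Subgroup.normalClosure R, ∀ (l : List (FreeGroup X × FreeGroup X)) (A : ℕ),
      IsRelatorExpression T w l → l.length ≤ A → (∀ p ∈ l, p.1.norm ≤ A) →
        AreaLE R w (C * A * (A + 1)) := by
  obtain ⟨C₁, hC₁⟩ := exists_areaLE_list_prod_of_commute hcomm
  obtain ⟨C₂, hC₂⟩ := exists_areaEq_conj hconj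
  have hT' : (T ∪ T⁻¹).Finite := hT.union hT.inv
  choose τ hτ using hTζ
  have := hT'.to_subtype
  obtain ⟨C₃, hC₃⟩ := exists_areaLE_of_finite
    (Set.finite_range fun r : ↥(T ∪ T⁻¹) => r.1 * (ζ (τ r.1 r.2))⁻¹)
    (by rintro _ ⟨r, rfl⟩; exact hτ r.1 r.2)
  refine ⟨C₁ + C₂ + C₃, fun w hw l A hl hlA hA => ?_⟩
  have key : ∀ l : List (FreeGroup X × FreeGroup X), (∀ p ∈ l, p.2 ∈ T ∨ p.2⁻¹ ∈ T) →
      (∀ p ∈ l, p.1.norm ≤ A) → ∃ js : List ι, js.length = l.length ∧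
        AreaEq R (l.map fun p => p.1⁻¹ * p.2 * p.1).prod (js.map ζ).prod
          ((C₃ + C₂ * A) * l.length) := by
    intro l
    induction l with
    | nil => exact fun _ _ => ⟨[], rfl, by simpa using AreaEq.refl _⟩
    | cons p l ih =>
      intro h1 h2
      obtain ⟨js, hjs, hE⟩ := ih (fun q hq => h1 q (List.mem_cons_of_mem _ hq))
        (fun q hq => h2 q (List.mem_cons_of_mem _ hq))
      have hr : AreaEq R p.2 (ζ (τ p.2 (h1 p (by simp)))) C₃ :=
        hC₃ _ ⟨⟨p.2, h1 p (by simp)⟩, rfl⟩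
      obtain ⟨j, hj⟩ := hC₂ p.1 (τ p.2 (h1 p (by simp)))
      refine ⟨j :: js, by simp [hjs], ?_⟩
      have hp : p.1.norm ≤ A := h2 p (by simp)
      have := ((hr.conj p.1).trans hj).mul hE
      rw [List.map_cons, List.map_cons, List.prod_cons, List.prod_cons]
      refine this.mono ?_
      rw [List.length_cons, mul_add, mul_one, add_comm]
      gcongr
  obtain ⟨js, hjs, hE⟩ := key l hl.1 hA
  rw [← hl.2] at hE
  refine (hE.areaLE (hC₁ js (hE.mem_iff.1 hw))).mono ?_
  rw [hjs]
  calc _ ≤ (C₃ + C₂ * A) * A + C₁ * A ^ 2 := by gcongr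
    _ ≤ _ := by nlinarith [Nat.zero_le (C₁ * A), Nat.zero_le (C₂ * A), Nat.zero_le (C₃ * A * A)]

end Commuting

/-! ### Rewriting relator expressions over a finite-index image. -/

section Transfer

open FreeGroup (mk of mk_toWord one_eq_mk mul_mk inv_mk norm_mk_le norm_inv_eq)

variable {X B : Type*}

theorem FreeGroup.norm_map_le_of_letters [DecidableEq X] [DecidableEq B]
    (f : FreeGroup X →* FreeGroup B) {C : ℕ} (hC : ∀ x : X × Bool, (f (mk [x])).norm ≤ C)
    (w : FreeGroup X) : (f w).norm ≤ C * w.norm := by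
  suffices H : ∀ L : List (X × Bool), (f (mk L)).norm ≤ C * L.length by
    have := H w.toWord
    rwa [mk_toWord] at this
  intro L
  induction L with
  | nil => simp [← one_eq_mk]
  | cons x L ih =>
    have h3 : mk (x :: L) = mk [x] * mk L := by rw [mul_mk]; rfl
    have h4 := hC x
    rw [h3, _root_.map_mul, List.length_cons, mul_add, mul_one]
    exact (FreeGroup.norm_mul_le _ _).trans (by linarith)

theorem FreeGroup.exists_norm_map_le [Finite X] [DecidableEq X] [DecidableEq B]
    (f : FreeGroup X →* FreeGroup B) : ∃ C, ∀ w, (f w).norm ≤ C * w.norm := by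
  obtain ⟨C, hC⟩ := (Set.finite_range fun x : X × Bool => (f (mk [x])).norm).bddAbove
  exact ⟨C, FreeGroup.norm_map_le_of_letters f fun x => hC ⟨x, rfl⟩⟩

/-- An endomorphism `f` of a free group satisfies `w = u f(w)`, where `u` is a product of `|w|`
conjugates of the words `x f(x)⁻¹`, for letters `x`, by words of length at most `|w|`. -/
theorem exists_isRelatorExpression_mul_map_inv [DecidableEq X] (f : FreeGroup X →* FreeGroup X)
    (w : FreeGroup X) :
    ∃ l, IsRelatorExpression (Set.range fun x : X × Bool => mk [x] * (f (mk [x]))⁻¹)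
      (w * (f w)⁻¹) l ∧ l.length = w.norm ∧ ∀ p ∈ l, p.1.norm ≤ w.norm := by
  suffices H : ∀ L : List (X × Bool),
      ∃ l, IsRelatorExpression (Set.range fun x : X × Bool => mk [x] * (f (mk [x]))⁻¹)
        (mk L * (f (mk L))⁻¹) l ∧ l.length = L.length ∧ ∀ p ∈ l, p.1.norm ≤ L.length by
    have := H w.toWord
    rwa [mk_toWord] at this
  intro L
  induction L with
  | nil => exact ⟨[], ⟨by simp, by simp [← one_eq_mk]⟩, rfl, by simp⟩
  | cons x L ih =>
    obtain ⟨l, hl, hlen, hn⟩ := ih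
    have h3 : mk (x :: L) = mk [x] * mk L := by rw [mul_mk]; rfl
    refine ⟨l.map (fun p => (p.1 * (mk [x])⁻¹, p.2)) ++ [(1, mk [x] * (f (mk [x]))⁻¹)],
      ⟨?_, ?_⟩, by simp [hlen], ?_⟩
    · intro p hp
      rcases List.mem_append.1 hp with h | h
      · obtain ⟨q, hq, rfl⟩ := List.mem_map.1 h
        exact hl.1 q hq
      · obtain rfl := List.mem_singleton.1 h
        exact .inl ⟨x, rfl⟩
    · have key : ∀ (c : FreeGroup X) (l : List (FreeGroup X × FreeGroup X)),
          ((l.map fun p => (p.1 * c⁻¹, p.2)).map fun p => p.1⁻¹ * p.2 * p.1).prod =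
            c * (l.map fun p => p.1⁻¹ * p.2 * p.1).prod * c⁻¹ := by
        intro c l
        induction l with
        | nil => simp
        | cons p l ih =>
          rw [List.map_cons, List.map_cons, List.map_cons, List.prod_cons, List.prod_cons, ih]
          group
      rw [List.map_append, List.prod_append, key, ← hl.2, h3, map_mul]
      simp [mul_assoc, -mul_mk, -inv_mk]
    · intro p hp
      rcases List.mem_append.1 hp with h | h
      · obtain ⟨q, hq, rfl⟩ := List.mem_map.1 h
        refine (FreeGroup.norm_mul_le _ _).trans ?_
        rw [norm_inv_eq, List.length_cons]
        exact add_le_add (hn q hq) norm_mk_le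
      · obtain rfl := List.mem_singleton.1 h
        simp

variable {Γ : Type*} [Group Γ]

/-- Rewriting words of a free group mapping to `Γ` as words in generators of the subgroup
`η.range`: a crossed homomorphism with values in the functions on the coset space. -/
theorem exists_rewriting_cocycle [Finite B] [DecidableEq X] [DecidableEq B]
    (η : FreeGroup X →* Γ) [η.range.FiniteIndex] (β : FreeGroup B →* Γ) :
    ∃ (s : Γ ⧸ η.range → Γ) (ρ : FreeGroup B → Γ ⧸ η.range → FreeGroup X) (K : ℕ),
      (∀ i, (s i : Γ ⧸ η.range) = i) ∧
      (∀ f g i, ρ (f * g) i = ρ f (β g • i) * ρ g i) ∧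
      (∀ f i, η (ρ f i) = (s (β f • i))⁻¹ * β f * s i) ∧
      ∀ f i, (ρ f i).norm ≤ K * f.norm := by
  have hs : ∀ i : Γ ⧸ η.range, ((Quotient.out i : Γ) : Γ ⧸ η.range) = i := Quotient.out_eq
  have hσ : ∀ (b : B) (i : Γ ⧸ η.range), ∃ u : FreeGroup X,
      η u = (Quotient.out (β (of b) • i))⁻¹ * β (of b) * Quotient.out i := by
    intro b i
    have h : ((Quotient.out (β (of b) • i) : Γ) : Γ ⧸ η.range) =
        ((β (of b) * Quotient.out i : Γ) : Γ ⧸ η.range) := by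
      rw [hs, ← smul_eq_mul, ← MulAction.Quotient.smul_coe, hs]
    rw [QuotientGroup.eq, ← mul_assoc] at h
    exact h
  choose σ hσ using hσ
  -- The cocycle is obtained from an action of the free group on cosets times $F(X)$, which may be
  -- prescribed freely on letters. As $F(X)$ acts on itself by left multiplication here, composition
  -- of permutations is the cocycle identity.
  let e : B → Equiv.Perm ((Γ ⧸ η.range) × FreeGroup X) := fun b =>
    { toFun := fun p => (β (of b) • p.1, σ b p.1 * p.2)
      invFun := fun p => ((β (of b))⁻¹ • p.1, (σ b ((β (of b))⁻¹ • p.1))⁻¹ * p.2)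
      left_inv := fun p => by simp
      right_inv := fun p => by simp }
  let Φ : FreeGroup B →* Equiv.Perm ((Γ ⧸ η.range) × FreeGroup X) := FreeGroup.lift e
  have hΦ : ∀ f, ∃ r : Γ ⧸ η.range → FreeGroup X,
      (∀ i u, Φ f (i, u) = (β f • i, r i * u)) ∧
        ∀ i, η (r i) = (Quotient.out (β f • i))⁻¹ * β f * Quotient.out i := by
    intro f
    induction f using FreeGroup.induction_on with
    | C1 => exact ⟨fun _ => 1, by simp, by simp⟩
    | of b => exact ⟨σ b, fun i u => by simp [Φ, e], hσ b⟩
    | inv_of b _ =>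
      refine ⟨fun i => (σ b ((β (of b))⁻¹ • i))⁻¹, fun i u => ?_, fun i => ?_⟩
      · have : (Φ (of b))⁻¹ = (e b)⁻¹ := by simp [Φ]
        rw [map_inv, this, map_inv]
        rfl
      · rw [map_inv, hσ, map_inv]
        simp [mul_assoc]
    | mul f g hf hg =>
      obtain ⟨r, hr, hr'⟩ := hf
      obtain ⟨q, hq, hq'⟩ := hg
      refine ⟨fun i => r (β g • i) * q i, fun i u => ?_, fun i => ?_⟩
      · rw [map_mul, Equiv.Perm.mul_apply, hq, hr, map_mul, mul_smul, mul_assoc]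
      · rw [map_mul, hr', hq', map_mul, mul_smul]
        group
  choose ρ hρ hρη using hΦ
  have hmul : ∀ f g i, ρ (f * g) i = ρ f (β g • i) * ρ g i := by
    intro f g i
    have h1 := hρ (f * g) i 1
    rw [map_mul Φ, Equiv.Perm.mul_apply, hρ g, hρ f] at h1
    simpa using (congrArg Prod.snd h1).symm
  have hone : ∀ i, ρ 1 i = 1 := fun i => by simpa using hmul 1 1 i
  obtain ⟨K, hK⟩ := (Set.finite_range fun p : (B × Bool) × (Γ ⧸ η.range) =>
    (ρ (mk [p.1]) p.2).norm).bddAbove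
  refine ⟨Quotient.out, ρ, K, hs, hmul, hρη, fun f => ?_⟩
  suffices H : ∀ (L : List (B × Bool)) i, (ρ (mk L) i).norm ≤ K * L.length by
    have := H f.toWord
    rwa [mk_toWord] at this
  intro L
  induction L with
  | nil => simp [← one_eq_mk, hone]
  | cons x L ih =>
    intro i
    have h3 : mk (x :: L) = mk [x] * mk L := by rw [mul_mk]; rfl
    have h4 : (ρ (mk [x]) (β (mk L) • i)).norm ≤ K := hK ⟨(x, _), rfl⟩
    have := ih i
    rw [h3, hmul, List.length_cons, mul_add, mul_one]
    exact (FreeGroup.norm_mul_le _ _).trans (by linarith)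

/-- Let `η : F(X) → Γ` have image of finite index and let `β : F(B) → Γ` be surjective. Relator
expressions over a finite set of words `T ⊆ ker β` can be transformed into relator expressions over
a finite set `T' ⊆ ker η`, with control on the lengths of the conjugators. -/
theorem exists_transfer_of_finiteIndex [Finite X] [Finite B] [DecidableEq X] [DecidableEq B]
    (η : FreeGroup X →* Γ) [η.range.FiniteIndex] (β : FreeGroup B →* Γ)
    (hβ : Function.Surjective β) {T : Set (FreeGroup B)} (hT : T.Finite) (hTβ : T ⊆ β.ker) :
    ∃ T' : Set (FreeGroup X), T'.Finite ∧ T' ⊆ η.ker ∧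
      ∃ (κ : FreeGroup X →* FreeGroup B) (C : ℕ), β.comp κ = η ∧
        (∀ w, (κ w).norm ≤ C * w.norm) ∧
        ∀ w A, AreaLE T (κ w) A → ∃ l, IsRelatorExpression T' w l ∧
          l.length ≤ C * (A + w.norm + 1) ∧ ∀ p ∈ l, p.1.norm ≤ C * (A + w.norm + 1) := by
  obtain ⟨s, ρ, K, hs, hmul, hρη, hρn⟩ := exists_rewriting_cocycle η β
  choose τ hτ using hβ
  let κ : FreeGroup X →* FreeGroup B := FreeGroup.lift fun x => τ (η (of x))
  have hκ : β.comp κ = η := by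
    ext x
    simp [κ, hτ]
  have hκ' : ∀ w, β (κ w) = η w := fun w => DFunLike.congr_fun hκ w
  obtain ⟨C₀, hC₀⟩ := FreeGroup.exists_norm_map_le κ
  obtain ⟨K', hK'⟩ := (hT.image FreeGroup.norm).bddAbove
  have hK' : ∀ t ∈ T, t.norm ≤ K' := fun t ht => hK' ⟨t, ht, rfl⟩
  have hone : ∀ i, ρ 1 i = 1 := fun i => by simpa using hmul 1 1 i
  let i₀ : Γ ⧸ η.range := ((1 : Γ) : Γ ⧸ η.range)
  have hi₀ : ∀ w, η w • i₀ = i₀ := by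
    intro w
    rw [MulAction.Quotient.smul_coe, QuotientGroup.eq]
    simp
  obtain ⟨c, hc⟩ : ∃ c, η c = s i₀ := by
    have := hs i₀
    rw [eq_comm, QuotientGroup.eq] at this
    simpa using this
  -- The words $\kappa(w)$ fix the base coset $i_0$, so the cocycle is a homomorphism on them.
  -- Conjugating by $c$ undoes the representative $s(i_0)$, so that $\eta\circ f=\eta$.
  let f : FreeGroup X →* FreeGroup X := MonoidHom.mk' (fun w => c * ρ (κ w) i₀ * c⁻¹) (by
    intro u v
    rw [map_mul, hmul, hκ', hi₀]
    group)
  have hf : ∀ w, η (f w) = η w := by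
    intro w
    change η (c * ρ (κ w) i₀ * c⁻¹) = η w
    rw [map_mul, map_mul, hρη, hκ', hi₀, map_inv, hc]
    group
  have hconj : ∀ (t : FreeGroup B) (θ : FreeGroup B), β t = 1 →
      ρ (θ⁻¹ * t * θ) i₀ = (ρ θ i₀)⁻¹ * ρ t (β θ • i₀) * ρ θ i₀ := by
    intro t θ ht
    have h1 : ρ θ⁻¹ (β θ • i₀) = (ρ θ i₀)⁻¹ := by
      have := hmul θ⁻¹ θ i₀
      rw [inv_mul_cancel, hone] at this
      exact eq_inv_of_mul_eq_one_left this.symm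
    rw [hmul, hmul, ht, one_smul, h1]
  have hinv : ∀ (t : FreeGroup B) i, β t = 1 → ρ t⁻¹ i = (ρ t i)⁻¹ := by
    intro t i ht
    have := hmul t⁻¹ t i
    rw [inv_mul_cancel, hone, ht, one_smul] at this
    exact eq_inv_of_mul_eq_one_left this.symm
  -- In $w=(wf(w)^{-1})\,f(w)$ the first factor is a product of conjugates of `T₁`. Elements of
  -- $\ker\beta$ act trivially on the cosets, so a relator expression of $\kappa(w)$ becomes one of
  -- $f(w)$ over `T₂`.
  let T₁ : Set (FreeGroup X) := Set.range fun x : X × Bool => mk [x] * (f (mk [x]))⁻¹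
  let T₂ : Set (FreeGroup X) := Set.image2 ρ T Set.univ
  refine ⟨T₁ ∪ T₂, (Set.finite_range _).union (hT.image2 _ Set.finite_univ), ?_, κ,
    C₀ + (K * C₀ + K * K' + c.norm + 1), hκ, fun w => (hC₀ w).trans (by gcongr; omega), ?_⟩
  · rintro _ (⟨x, rfl⟩ | ⟨t, ht, i, -, rfl⟩)
    · simp [MonoidHom.mem_ker, hf, -mul_mk, -inv_mk]
    · rw [SetLike.mem_coe, MonoidHom.mem_ker, hρη, hTβ ht]
      simp
  · rintro w A ⟨l₀, hl₀, hA⟩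
    -- The conjugators are shortened beforehand, since $\rho$ only stretches lengths by a factor
    -- $K$.
    obtain ⟨l, hl, hlen, hn⟩ := hl₀.exists_norm_le hK'
    rw [← hlen] at hA
    obtain ⟨l₁, hl₁, hlen₁, hn₁⟩ := exists_isRelatorExpression_mul_map_inv f w
    have hker : ∀ p ∈ l, β p.2 = 1 := by
      intro p hp
      rcases hl.1 p hp with h | h
      · exact hTβ h
      · simpa using hTβ h
    have key : ∀ l : List (FreeGroup B × FreeGroup B), (∀ p ∈ l, β p.2 = 1) →
        c * ρ (l.map fun p => p.1⁻¹ * p.2 * p.1).prod i₀ * c⁻¹ =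
          ((l.map fun p => (ρ p.1 i₀ * c⁻¹, ρ p.2 (β p.1 • i₀))).map
            fun p => p.1⁻¹ * p.2 * p.1).prod := by
      intro l
      induction l with
      | nil => simp [hone]
      | cons p l ih =>
        intro h
        have ih := ih fun q hq => h q (List.mem_cons_of_mem _ hq)
        have hl1 : β (l.map fun p => p.1⁻¹ * p.2 * p.1).prod = 1 := by
          rw [map_list_prod]
          refine List.prod_eq_one fun x hx => ?_
          simp only [List.map_map, List.mem_map] at hx
          obtain ⟨q, hq, rfl⟩ := hx
          simp [h q (List.mem_cons_of_mem _ hq)]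
        rw [List.map_cons, List.prod_cons, hmul, hl1, one_smul, hconj _ _ (h p (by simp)),
          List.map_cons, List.map_cons, List.prod_cons, ← ih]
        group
    refine ⟨l₁ ++ l.map fun p => (ρ p.1 i₀ * c⁻¹, ρ p.2 (β p.1 • i₀)), ⟨?_, ?_⟩, ?_, ?_⟩
    · intro p hp
      rcases List.mem_append.1 hp with h | h
      · exact (hl₁.1 p h).imp (.inl ·) (.inl ·)
      · obtain ⟨q, hq, rfl⟩ := List.mem_map.1 h
        rcases hl.1 q hq with h | h
        · exact .inl (.inr ⟨_, h, _, trivial, rfl⟩)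
        · exact .inr (.inr ⟨_, h, _, trivial, hinv _ _ (hker q hq)⟩)
    · rw [List.map_append, List.prod_append, ← hl₁.2, ← key l hker, ← hl.2]
      change w = w * (f w)⁻¹ * f w
      simp
    · rw [List.length_append, List.length_map, hlen₁]
      have : 1 ≤ C₀ + (K * C₀ + K * K' + c.norm + 1) := by omega
      nlinarith [Nat.mul_le_mul_right (A + w.norm + 1) this]
    · intro p hp
      rcases List.mem_append.1 hp with h | h
      · have h1 := hn₁ p h
        have : 1 ≤ C₀ + (K * C₀ + K * K' + c.norm + 1) := by omega
        nlinarith [Nat.mul_le_mul_right (A + w.norm + 1) this]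
      · obtain ⟨q, hq, rfl⟩ := List.mem_map.1 h
        have h1 := hn q hq
        rw [← hlen] at h1
        have h2 : q.1.norm ≤ C₀ * w.norm + K' * A :=
          h1.trans (add_le_add (hC₀ w) (by gcongr))
        calc (ρ q.1 i₀ * c⁻¹).norm ≤ K * q.1.norm + c.norm := by
              refine (FreeGroup.norm_mul_le _ _).trans ?_
              rw [norm_inv_eq]
              exact Nat.add_le_add_right (hρn _ _) _
          _ ≤ K * (C₀ * w.norm + K' * A) + c.norm := by gcongr
          _ = K * C₀ * w.norm + K * K' * A + c.norm * 1 := by ring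
          _ ≤ K * C₀ * (A + w.norm + 1) + K * K' * (A + w.norm + 1) +
              c.norm * (A + w.norm + 1) := by gcongr <;> omega
          _ = (K * C₀ + K * K' + c.norm) * (A + w.norm + 1) := by ring
          _ ≤ _ := Nat.mul_le_mul_right _ (by omega)

end Transfer

/-! ### The Dehn function of the third power of a group. -/

section Power

open FreeGroup (mk of mk_toWord one_eq_mk mul_mk inv_mk norm_mk_le norm_inv_eq)

variable {X Y : Type*}

theorem AreaLE.map {S : Set (FreeGroup Y)} {T : Set (FreeGroup X)} (f : FreeGroup Y →* FreeGroup X)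
    (hf : ∀ s ∈ S, f s ∈ T) {u : FreeGroup Y} {M : ℕ} (hu : AreaLE S u M) : AreaLE T (f u) M := by
  obtain ⟨l, hl, hM⟩ := hu
  refine ⟨l.map fun p => (f p.1, f p.2), ⟨?_, ?_⟩, by simpa⟩
  · intro p hp
    obtain ⟨q, hq, rfl⟩ := List.mem_map.1 hp
    exact (hl.1 q hq).imp (hf _ ·) fun h => by simpa using hf _ h
  · rw [hl.2, map_list_prod]
    simp [Function.comp_def]

/-- The inclusion of `F(Y)` as the `k`-th factor of the free product of three copies of it. -/
def tripleIncl (k : Fin 3) : FreeGroup Y →* FreeGroup (Fin 3 × Y) :=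
  FreeGroup.map fun y => (k, y)

/-- The projection of the free product of three copies of `F(Y)` onto the `k`-th factor. -/
def tripleProj (k : Fin 3) : FreeGroup (Fin 3 × Y) →* FreeGroup Y :=
  FreeGroup.lift fun p => if p.1 = k then of p.2 else 1

/-- The relators of the third power of a group with relators `S`. -/
def tripleRelators (S : Set (FreeGroup Y)) : Set (FreeGroup (Fin 3 × Y)) :=
  {r | ∃ x z : (Fin 3 × Y) × Bool, x.1.1 ≠ z.1.1 ∧
    r = mk [x] * mk [z] * (mk [z] * mk [x])⁻¹} ∪ ⋃ k, tripleIncl k '' S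

/-- The map from words in three alphabets to the third power of a group. -/
def tripleHom {G : Type*} [Group G] (ψ : FreeGroup Y →* G) :
    FreeGroup (Fin 3 × Y) →* (Fin 3 → G) :=
  MonoidHom.pi fun k => ψ.comp (tripleProj k)

theorem tripleHom_apply {G : Type*} [Group G] (ψ : FreeGroup Y →* G) (w : FreeGroup (Fin 3 × Y))
    (k : Fin 3) : tripleHom ψ w k = ψ (tripleProj k w) := rfl

theorem tripleIncl_cons (k : Fin 3) (y : Y × Bool) (L : List (Y × Bool)) :
    tripleIncl k (mk (y :: L)) = mk [((k, y.1), y.2)] * tripleIncl k (mk L) := by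
  rw [tripleIncl, FreeGroup.map.mk, FreeGroup.map.mk, mul_mk]
  rfl

theorem tripleProj_letter (k : Fin 3) (x : (Fin 3 × Y) × Bool) :
    tripleProj k (mk [x]) = if x.1.1 = k then mk [(x.1.2, x.2)] else 1 := by
  obtain ⟨⟨j, y⟩, b⟩ := x
  rw [tripleProj, FreeGroup.lift_mk]
  by_cases h : j = k <;> cases b <;> simp [h, of, FreeGroup.inv_mk, FreeGroup.invRev]

theorem tripleRelators_finite [Finite Y] {S : Set (FreeGroup Y)} (hS : S.Finite) :
    (tripleRelators S).Finite := by
  refine Set.Finite.union ?_ (Set.finite_iUnion fun k => hS.image _)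
  refine (Set.finite_range fun p : ((Fin 3 × Y) × Bool) × ((Fin 3 × Y) × Bool) =>
    mk [p.1] * mk [p.2] * (mk [p.2] * mk [p.1])⁻¹).subset ?_
  rintro _ ⟨x, z, -, rfl⟩
  exact ⟨(x, z), rfl⟩

theorem tripleProj_tripleIncl (k j : Fin 3) (u : FreeGroup Y) :
    tripleProj k (tripleIncl j u) = if j = k then u else 1 := by
  have : (tripleProj k).comp (tripleIncl j) =
      if j = k then MonoidHom.id (FreeGroup Y) else 1 := by
    ext y
    by_cases h : j = k <;> simp [tripleProj, tripleIncl, h]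
  have := DFunLike.congr_fun this u
  by_cases h : j = k <;> simpa [h] using this

theorem tripleHom_surjective {G : Type*} [Group G] {ψ : FreeGroup Y →* G}
    (hψ : Function.Surjective ψ) : Function.Surjective (tripleHom ψ) := by
  intro g
  choose τ hτ using hψ
  refine ⟨tripleIncl 0 (τ (g 0)) * tripleIncl 1 (τ (g 1)) * tripleIncl 2 (τ (g 2)), ?_⟩
  ext k
  fin_cases k <;> simp [tripleHom_apply, tripleProj_tripleIncl, hτ]

theorem tripleRelators_subset_ker {G : Type*} [Group G] {ψ : FreeGroup Y →* G}
    {S : Set (FreeGroup Y)} (hS : S ⊆ ψ.ker) : tripleRelators S ⊆ (tripleHom ψ).ker := by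
  rintro _ (⟨x, z, hxz, rfl⟩ | hr)
  · rw [SetLike.mem_coe, MonoidHom.mem_ker]
    ext k
    simp only [tripleHom_apply, Pi.one_apply, map_mul, map_inv,
      tripleProj_letter]
    by_cases h : x.1.1 = k
    · have h' : z.1.1 ≠ k := fun h' => hxz (h.trans h'.symm)
      simp [h']
    · simp [h]
  · obtain ⟨k, s, hs, rfl⟩ := Set.mem_iUnion.1 hr
    rw [SetLike.mem_coe, MonoidHom.mem_ker]
    ext j
    have := hS hs
    rw [SetLike.mem_coe, MonoidHom.mem_ker] at this
    simp only [tripleHom_apply, Pi.one_apply,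
      tripleProj_tripleIncl]
    split_ifs <;> simp [this]

theorem areaEq_letter_mul_tripleIncl [DecidableEq Y] (S : Set (FreeGroup Y))
    (x : (Fin 3 × Y) × Bool) (k : Fin 3) (hk : x.1.1 ≠ k) (v : FreeGroup Y) :
    AreaEq (tripleRelators S) (mk [x] * tripleIncl k v) (tripleIncl k v * mk [x]) v.norm := by
  suffices H : ∀ L : List (Y × Bool), AreaEq (tripleRelators S) (mk [x] * tripleIncl k (mk L))
      (tripleIncl k (mk L) * mk [x]) L.length by
    have := H v.toWord
    rwa [mk_toWord] at this
  intro L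
  induction L with
  | nil => simpa [← one_eq_mk] using AreaEq.refl _
  | cons y L ih =>
    rw [tripleIncl_cons, List.length_cons, add_comm]
    have h1 : AreaEq (tripleRelators S) (mk [x] * mk [((k, y.1), y.2)])
        (mk [((k, y.1), y.2)] * mk [x]) 1 :=
      AreaLE.of_mem_relators (.inl ⟨x, _, hk, rfl⟩)
    have h2 := (h1.mul_right (tripleIncl k (mk L))).trans
      (by simpa only [mul_assoc] using ih.mul_left (mk [((k, y.1), y.2)]))
    simpa only [mul_assoc] using h2

theorem tripleProj_norm_le [DecidableEq Y] (k : Fin 3) (w : FreeGroup (Fin 3 × Y)) :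
    (tripleProj k w).norm ≤ w.norm := by
  have := FreeGroup.norm_map_le_of_letters (tripleProj k) (C := 1) (fun x => by
    rw [tripleProj_letter]
    split_ifs
    · exact norm_mk_le
    · simp) w
  simpa using this

/-- A new first letter passes at most two blocks, each no longer than the old word, and $2m^2+2m\le
2(m+1)^2$. -/
theorem areaEq_tripleIncl_tripleProj [DecidableEq Y] (S : Set (FreeGroup Y))
    (w : FreeGroup (Fin 3 × Y)) :
    AreaEq (tripleRelators S) w (tripleIncl 0 (tripleProj 0 w) *
      (tripleIncl 1 (tripleProj 1 w) * tripleIncl 2 (tripleProj 2 w))) (2 * w.norm ^ 2) := by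
  suffices H : ∀ L : List ((Fin 3 × Y) × Bool), AreaEq (tripleRelators S) (mk L)
      (tripleIncl 0 (tripleProj 0 (mk L)) * (tripleIncl 1 (tripleProj 1 (mk L)) *
        tripleIncl 2 (tripleProj 2 (mk L)))) (2 * L.length ^ 2) by
    have := H w.toWord
    rwa [mk_toWord] at this
  intro L
  induction L with
  | nil => simpa [← one_eq_mk] using AreaEq.refl _
  | cons x L ih =>
    have h3 : mk (x :: L) = mk [x] * mk L := by rw [mul_mk]; rfl
    have hn : ∀ k, (tripleProj k (mk L)).norm ≤ L.length := fun k =>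
      (tripleProj_norm_le k _).trans norm_mk_le
    have hC : ∀ k, x.1.1 ≠ k → AreaEq (tripleRelators S)
        (mk [x] * tripleIncl k (tripleProj k (mk L)))
        (tripleIncl k (tripleProj k (mk L)) * mk [x]) L.length := fun k hk =>
      (areaEq_letter_mul_tripleIncl S x k hk _).mono (hn k)
    have hI : ∀ k, tripleIncl k (tripleProj k (mk [x])) = if x.1.1 = k then mk [x] else 1 := by
      intro k
      rw [tripleProj_letter]
      split_ifs with h
      · subst h
        rw [tripleIncl, FreeGroup.map.mk]
        rfl
      · simp
    have hle : 2 * L.length ^ 2 + (L.length + L.length) ≤ 2 * (x :: L).length ^ 2 := by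
      rw [List.length_cons]; nlinarith
    simp only [h3, map_mul, hI]
    have ih' := ih.mul_left (mk [x])
    have hC₀ := hC 0
    have hC₁ := hC 1
    generalize tripleIncl 0 (tripleProj 0 (mk L)) = a₀ at *
    generalize tripleIncl 1 (tripleProj 1 (mk L)) = a₁ at *
    generalize tripleIncl 2 (tripleProj 2 (mk L)) = a₂ at *
    have hk : x.1.1 = 0 ∨ x.1.1 = 1 ∨ x.1.1 = 2 := by omega
    rcases hk with hk | hk | hk <;> rw [hk] at hC₀ hC₁ ⊢
    · refine AreaEq.mono ?_ ((Nat.le_add_right _ _).trans hle)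
      simpa [mul_assoc, -mul_mk] using ih'
    · have h := ih'.trans (by simpa only [mul_assoc] using (hC₀ (by simp)).mul_right (a₁ * a₂))
      refine AreaEq.mono ?_ ((Nat.add_le_add_left (Nat.le_add_right _ _) _).trans hle)
      simpa [mul_assoc, -mul_mk] using h
    · have h := (ih'.trans
        (by simpa only [mul_assoc] using (hC₀ (by simp)).mul_right (a₁ * a₂))).trans
        (by simpa only [mul_assoc] using ((hC₁ (by simp)).mul_right a₂).mul_left a₀)
      rw [add_assoc] at h
      refine AreaEq.mono ?_ hle
      simpa [mul_assoc, -mul_mk] using h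

/-- A word of length `n` representing the identity in the third power of a group with presentation
`⟨Y ∣ S⟩` has area at most `2n² + 3δ(n)`. -/
theorem areaLE_tripleRelators [Finite Y] [DecidableEq Y] {G : Type*} [Group G]
    {ψ : FreeGroup Y →* G} {S : Set (FreeGroup Y)} (hS : Subgroup.normalClosure S = ψ.ker)
    {w : FreeGroup (Fin 3 × Y)} (hw : w ∈ (tripleHom ψ).ker) {n : ℕ} (hn : w.norm ≤ n) :
    AreaLE (tripleRelators S) w (2 * n ^ 2 + 3 * dehnFunction S n) := by
  have h : ∀ k, AreaLE (tripleRelators S) (tripleIncl k (tripleProj k w)) (dehnFunction S n) := by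
    intro k
    refine (AreaLE.le_dehnFunction (R := S) ?_ ((tripleProj_norm_le k w).trans hn)).map
      (tripleIncl k) fun s hs => .inr (Set.mem_iUnion.2 ⟨k, s, hs, rfl⟩)
    rw [hS, MonoidHom.mem_ker]
    exact congrFun hw k
  refine ((areaEq_tripleIncl_tripleProj S w).areaLE ((h 0).mul ((h 1).mul (h 2)))).mono ?_
  have : w.norm ^ 2 ≤ n ^ 2 := Nat.pow_le_pow_left hn 2
  omega

end Power

/-! ### Finitely presented quotients of finitely generated groups. -/

section FinitelyPresentedQuotient

/-- If a quotient of a finitely generated group is finitely presented, then the kernel is the normal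
closure of a finite set. -/
theorem Subgroup.isFinitelyNormallyGenerated_of_quotient {P : Type*} [Group P] [hP : Group.FG P]
    (K : Subgroup P) [K.Normal] (hK : Group.IsFinitelyPresented (P ⧸ K)) :
    K.IsFinitelyNormallyGenerated := by
  obtain ⟨n, φ, hφ, R, hR, hRφ⟩ := hK.out
  obtain ⟨S, hS⟩ := Group.fg_def.1 hP
  choose lift hlift using QuotientGroup.mk'_surjective K
  let Φ : FreeGroup (Fin n) →* P := FreeGroup.lift fun i => lift (φ (FreeGroup.of i))
  have hΦ : ∀ v, (QuotientGroup.mk' K) (Φ v) = φ v := by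
    intro v
    have : (QuotientGroup.mk' K).comp Φ = φ := by
      ext i
      simp only [MonoidHom.comp_apply, Φ, FreeGroup.lift_apply_of, hlift]
    exact DFunLike.congr_fun this v
  choose u hu using fun p : P => hφ (QuotientGroup.mk' K p)
  -- The second family makes $\Phi$ surjective modulo `R'`; the first then makes the relations of
  -- the quotient hold there.
  let R' : Set P := Φ '' R ∪ (fun p => p * (Φ (u p))⁻¹) '' S
  have hR'K : Subgroup.normalClosure R' ≤ K := by
    refine Subgroup.normalClosure_le_normal ?_
    rintro _ (⟨r, hr, rfl⟩ | ⟨p, -, rfl⟩)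
    · have : φ r = 1 := by
        rw [← MonoidHom.mem_ker, ← hRφ]
        exact Subgroup.subset_normalClosure hr
      rw [← hΦ, ← MonoidHom.mem_ker, QuotientGroup.ker_mk'] at this
      exact this
    · rw [SetLike.mem_coe, ← QuotientGroup.ker_mk' K, MonoidHom.mem_ker, map_mul, map_inv, hΦ, hu]
      simp
  refine ⟨R', (hR.image _).union (S.finite_toSet.image _), le_antisymm hR'K ?_⟩
  intro x hx
  let q := QuotientGroup.mk' (Subgroup.normalClosure R')
  have hq : ∀ r ∈ R', q r = 1 := fun r hr => by
    rw [← MonoidHom.mem_ker, QuotientGroup.ker_mk']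
    exact Subgroup.subset_normalClosure hr
  have hsurj : (⊤ : Subgroup P) ≤ (q.comp Φ).range.comap q := by
    rw [← hS, Subgroup.closure_le]
    intro p hp
    refine ⟨u p, ?_⟩
    have := hq _ (.inr ⟨p, hp, rfl⟩)
    rw [map_mul, map_inv, mul_inv_eq_one] at this
    exact this.symm
  obtain ⟨v, hv⟩ := hsurj (Subgroup.mem_top x)
  have hvker : v ∈ φ.ker := by
    have h1 : (Φ v)⁻¹ * x ∈ Subgroup.normalClosure R' := by
      rw [← QuotientGroup.ker_mk' (Subgroup.normalClosure R'), MonoidHom.mem_ker, map_mul, map_inv,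
        inv_mul_eq_one]
      exact hv
    have h2 : Φ v ∈ K := by
      have := K.mul_mem hx (K.inv_mem (hR'K h1))
      simpa using this
    rw [MonoidHom.mem_ker, ← hΦ, ← MonoidHom.mem_ker, QuotientGroup.ker_mk']
    exact h2
  have : Subgroup.normalClosure R ≤ (q.comp Φ).ker :=
    Subgroup.normalClosure_le_normal fun r hr => hq _ (.inl ⟨r, hr, rfl⟩)
  have hv1 : q (Φ v) = 1 := this (hRφ ▸ hvker)
  rw [← QuotientGroup.ker_mk' (Subgroup.normalClosure R'), MonoidHom.mem_ker]
  exact hv.symm.trans hv1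

instance Monoid.Coprod.fg {G H : Type*} [Group G] [Group H] [Group.FG G] [Group.FG H] :
    Group.FG (Monoid.Coprod G H) := by
  rw [Group.fg_def, ← Monoid.Coprod.range_inl_sup_range_inr]
  exact ((Group.fg_iff_subgroup_fg _).1 inferInstance).sup
    ((Group.fg_iff_subgroup_fg _).1 inferInstance)

end FinitelyPresentedQuotient

/-! ### Transpositions and the translation of $\mathbb Z$. -/

section Shift

open Equiv Filter

/-- The translation of `ℤ` by one. -/
def shiftPerm : Perm ℤ := Equiv.addRight 1

theorem shiftPerm_zpow_apply (n m : ℤ) : (shiftPerm ^ n) m = m + n := by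
  simp [shiftPerm]

theorem shiftPerm_zpow_mul_swap (n a b : ℤ) :
    shiftPerm ^ n * swap a b * (shiftPerm ^ n)⁻¹ = swap (a + n) (b + n) := by
  rw [← swap_apply_apply, shiftPerm_zpow_apply, shiftPerm_zpow_apply]

/-- The sequence of transpositions `(0 k)` of `ℤ`, up to eventual equality. -/
def swapGerm : Germ (atTop : Filter ℕ) (Perm ℤ) := ((fun k : ℕ => swap (0 : ℤ) k : ℕ → Perm ℤ) :)

/-- The constant sequence with value the translation of `ℤ` by one. -/
def shiftGerm : Germ (atTop : Filter ℕ) (Perm ℤ) := ((fun _ => shiftPerm : ℕ → Perm ℤ) :)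

/-- The subgroup generated by the conjugates of `swapGerm` by powers of the translation. -/
def swapGermClosure : Subgroup (Germ (atTop : Filter ℕ) (Perm ℤ)) :=
  Subgroup.closure (Set.range fun n : ℤ => shiftGerm ^ n * swapGerm * (shiftGerm ^ n)⁻¹)

theorem shiftGerm_conj_swapGerm (n : ℤ) : shiftGerm ^ n * swapGerm * (shiftGerm ^ n)⁻¹ =
    ((fun k : ℕ => swap n (k + n) : ℕ → Perm ℤ) :) := by
  have : shiftGerm ^ n * swapGerm * (shiftGerm ^ n)⁻¹ =
    ((fun k : ℕ => shiftPerm ^ n * swap (0 : ℤ) k * (shiftPerm ^ n)⁻¹ : ℕ → Perm ℤ) :) := rfl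
  rw [this]
  simp only [shiftPerm_zpow_mul_swap, zero_add]

/-- The transpositions $(n\ \,n+k)$ and $(m\ \,m+k)$ with $n\ne m$ are disjoint as soon as
$k>|n-m|$. For a fixed $k$ they can fail to commute, hence the use of germs. -/
theorem commute_shiftGerm_conj (n m : ℤ) :
    Commute (shiftGerm ^ n * swapGerm * (shiftGerm ^ n)⁻¹)
      (shiftGerm ^ m * swapGerm * (shiftGerm ^ m)⁻¹) := by
  rcases eq_or_ne n m with rfl | h
  · exact Commute.refl _
  rw [shiftGerm_conj_swapGerm, shiftGerm_conj_swapGerm]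
  refine Germ.coe_eq.2 ?_
  filter_upwards [eventually_gt_atTop (n - m).natAbs] with k hk
  refine (Equiv.Perm.disjoint_swap_swap ?_).commute
  simp only [List.nodup_cons, List.mem_cons, List.not_mem_nil, or_false, not_or, not_false_eq_true,
    List.nodup_nil, and_true]
  omega

theorem commute_of_mem_swapGermClosure {x y : Germ (atTop : Filter ℕ) (Perm ℤ)}
    (hx : x ∈ swapGermClosure) (hy : y ∈ swapGermClosure) : Commute x y := by
  have h := Subgroup.closure_le_centralizer_centralizer
    (Set.range fun n : ℤ => shiftGerm ^ n * swapGerm * (shiftGerm ^ n)⁻¹)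
  have h1 : swapGermClosure ≤ Subgroup.centralizer
      (Set.range fun n : ℤ => shiftGerm ^ n * swapGerm * (shiftGerm ^ n)⁻¹) := by
    refine (Subgroup.closure_le _).2 ?_
    rintro _ ⟨n, rfl⟩ _ ⟨m, rfl⟩
    exact commute_shiftGerm_conj m n
  exact Subgroup.mem_centralizer_iff.1 (h hy) x (h1 hx)

theorem shiftGerm_conj_mem (n : ℤ) {x : Germ (atTop : Filter ℕ) (Perm ℤ)}
    (hx : x ∈ swapGermClosure) : shiftGerm ^ n * x * (shiftGerm ^ n)⁻¹ ∈ swapGermClosure := by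
  have : swapGermClosure ≤ swapGermClosure.comap (MulAut.conj (shiftGerm ^ n)).toMonoidHom := by
    refine (Subgroup.closure_le _).2 ?_
    rintro _ ⟨m, rfl⟩
    refine Subgroup.subset_closure ⟨n + m, ?_⟩
    simp only [MulEquiv.toMonoidHom_eq_coe, MonoidHom.coe_coe, MulAut.conj_apply, zpow_add]
    group
  exact this hx

theorem zpow_mul_swapGerm_mem (n : ℤ) :
    (shiftGerm * swapGerm) ^ n * (shiftGerm ^ n)⁻¹ ∈ swapGermClosure := by
  have h0 : swapGerm ∈ swapGermClosure := Subgroup.subset_closure ⟨0, by simp⟩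
  induction n using Int.induction_on with
  | zero => simp
  | succ n ih =>
    have := shiftGerm_conj_mem 1 (mul_mem h0 ih)
    convert this using 1
    rw [add_comm, zpow_add, zpow_add]
    group
  | pred n ih =>
    have := mul_mem (inv_mem h0) (shiftGerm_conj_mem (-1) ih)
    convert this using 1
    rw [sub_eq_neg_add, zpow_add, zpow_add]
    group

end Shift

/-! ### Finiteness of the abelianization. -/

section Abelianization

open Equiv Filter Monoid.Coprod
open scoped commutatorElement

variable {G : Type*} [Group G]

/-- The homomorphism from `G ∗ Ḡ` to the permutations of `ℤ` induced by a character `χ` of `G`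
that maps an element `g` with `χ(g) = 1` to the translation and `ḡ` to the product of the
translation with the transposition `(0 k)`. -/
def shiftSwapHom (χ : G →* Multiplicative ℤ) (k : ℕ) : Monoid.Coprod G G →* Perm ℤ :=
  lift ((zpowersHom _ shiftPerm).comp χ) ((zpowersHom _ (shiftPerm * swap (0 : ℤ) k)).comp χ)

theorem shiftSwapHom_germ_mem (χ : G →* Multiplicative ℤ) (x : Monoid.Coprod G G) :
    ((fun k => shiftSwapHom χ k x : ℕ → Perm ℤ) : Germ (atTop : Filter ℕ) (Perm ℤ)) *
      (shiftGerm ^ (lift χ χ x).toAdd)⁻¹ ∈ swapGermClosure := by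
  induction x using Monoid.Coprod.induction_on with
  | inl g =>
    convert one_mem swapGermClosure
    rw [mul_inv_eq_one]
    rfl
  | inr g => exact zpow_mul_swapGerm_mem (χ g).toAdd
  | mul x y hx hy =>
    have := mul_mem hx (shiftGerm_conj_mem (lift χ χ x).toAdd hy)
    convert this using 1
    have h1 : ((fun k => shiftSwapHom χ k (x * y) : ℕ → Perm ℤ) :
        Germ (atTop : Filter ℕ) (Perm ℤ)) =
        ((fun k => shiftSwapHom χ k x : ℕ → Perm ℤ) : Germ (atTop : Filter ℕ) (Perm ℤ)) *
        ((fun k => shiftSwapHom χ k y : ℕ → Perm ℤ) : Germ (atTop : Filter ℕ) (Perm ℤ)) := by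
      simp only [map_mul]
      rfl
    rw [h1, map_mul, toAdd_mul, zpow_add]
    group

theorem SidkiE.D_le_ker {H : Type*} [CommGroup H] (f : Monoid.Coprod G G →* H) :
    SidkiE.D G ≤ f.ker := by
  refine Subgroup.commutator_le.2 fun x _ y _ => ?_
  rw [MonoidHom.mem_ker, map_commutatorElement, commutatorElement_eq_one_iff_commute]
  exact Commute.all _ _

theorem SidkiE.L_le_ker_lift {H : Type*} [Group H] (f : G →* H) :
    SidkiE.L G ≤ (lift f f).ker := by
  refine (Subgroup.closure_le _).2 ?_
  rintro _ ⟨g, rfl⟩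
  simp [MonoidHom.mem_ker]

/-- Both $\mathcal D$ and $\mathcal L$ have total $\chi$-exponent zero, so their germs lie in the
abelian group `swapGermClosure`. -/
theorem eventually_shiftSwapHom_eq_one (χ : G →* Multiplicative ℤ) {x : Monoid.Coprod G G}
    (hx : x ∈ Subgroup.normalClosure
      ((⁅SidkiE.D G, SidkiE.L G⁆ : Subgroup (Monoid.Coprod G G)) : Set (Monoid.Coprod G G))) :
    ∀ᶠ k in atTop, shiftSwapHom χ k x = 1 := by
  let F : Monoid.Coprod G G →* Germ (atTop : Filter ℕ) (Perm ℤ) :=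
    (Germ.coeMulHom _).comp (MonoidHom.pi (shiftSwapHom χ))
  suffices h : Subgroup.normalClosure
      ((⁅SidkiE.D G, SidkiE.L G⁆ : Subgroup (Monoid.Coprod G G)) : Set (Monoid.Coprod G G)) ≤
        F.ker from Germ.coe_eq.1 (h hx)
  refine Subgroup.normalClosure_le_normal (Subgroup.commutator_le.2 fun d hd l hl => ?_)
  have hker : ∀ y ∈ (lift χ χ).ker, F y ∈ swapGermClosure := by
    intro y hy
    have := shiftSwapHom_germ_mem χ y
    rw [MonoidHom.mem_ker.1 hy, toAdd_one, zpow_zero, inv_one, mul_one] at this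
    exact this
  rw [MonoidHom.mem_ker, map_commutatorElement, commutatorElement_eq_one_iff_commute]
  exact commute_of_mem_swapGermClosure (hker d (SidkiE.D_le_ker _ hd))
    (hker l (SidkiE.L_le_ker_lift χ hl))

theorem exists_shiftSwapHom_ne_one {χ : G →* Multiplicative ℤ} {g : G}
    (hg : χ g = Multiplicative.ofAdd 1) {k : ℕ} (hk : 0 < k) :
    ∃ x ∈ (⁅SidkiE.D G, SidkiE.L G⁆ : Subgroup (Monoid.Coprod G G)), shiftSwapHom χ k x ≠ 1 := by
  -- The inner commutator maps to $(k+1\ \,2k+1)(1\ \,k+1)$ and $\overline g g^{-1}$ to $(1\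
  -- \,k+1)$. The two orders of multiplication send $1$ to $1$ and to $2k+1$.
  refine ⟨⁅⁅inl (g ^ k), inr g⁆, inr g * (inl g)⁻¹⁆, Subgroup.commutator_mem_commutator
    (Subgroup.commutator_mem_commutator ⟨_, rfl⟩ ⟨_, rfl⟩) ?_, ?_⟩
  · have : (inl g⁻¹)⁻¹ * inr g⁻¹ ∈ SidkiE.L G := Subgroup.subset_closure ⟨g⁻¹, rfl⟩
    simpa using inv_mem this
  · rw [map_commutatorElement, Ne, commutatorElement_eq_one_iff_commute, map_commutatorElement]
    have hinl : shiftSwapHom χ k (inl g) = shiftPerm := by simp [shiftSwapHom, hg]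
    have hinr : shiftSwapHom χ k (inr g) = shiftPerm * swap (0 : ℤ) k := by
      simp [shiftSwapHom, hg]
    have h1 : shiftPerm * swap (0 : ℤ) k * shiftPerm⁻¹ = swap (1 : ℤ) (k + 1) := by
      simpa using shiftPerm_zpow_mul_swap 1 0 k
    have h2 : ⁅shiftPerm ^ k, shiftPerm * swap (0 : ℤ) k⁆ =
        swap (k + 1 : ℤ) (k + k + 1) * swap (1 : ℤ) (k + 1) := by
      have := shiftPerm_zpow_mul_swap (k + 1) 0 k
      have h3 : swap (k + 1 : ℤ) (k + k + 1) =
          shiftPerm ^ ((k : ℤ) + 1) * swap (0 : ℤ) k * (shiftPerm ^ ((k : ℤ) + 1))⁻¹ := by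
        rw [this, zero_add, add_assoc]
      rw [← h1, commutatorElement_def, h3, mul_inv_rev, swap_inv]
      group
    rw [map_mul, map_pow, map_pow, map_inv, hinl, hinr, h1, h2]
    intro h
    have h5 := DFunLike.congr_fun h.eq 1
    rw [Equiv.Perm.mul_apply, Equiv.Perm.mul_apply, Equiv.Perm.mul_apply, Equiv.Perm.mul_apply,
      Equiv.swap_apply_left, Equiv.swap_apply_right, Equiv.swap_apply_left,
      Equiv.swap_apply_of_ne_of_ne (by omega) (by omega),
      Equiv.swap_apply_of_ne_of_ne (by omega) (by omega)] at h5
    omega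

/-- If `ℰ(G)` is finitely presented, then `G` has finite abelianization. -/
theorem SidkiE.finite_abelianization [Group.FG G] (hE : Group.IsFinitelyPresented (SidkiE G)) :
    Finite (Abelianization G) := by
  have : Group.FG (Abelianization G) := Group.fg_of_surjective 
    (f := Abelianization.of) QuotientGroup.mk_surjective
  obtain ⟨n, ι, hι, p, hp, e, ⟨f⟩⟩ :=
    AddCommGroup.equiv_free_prod_directSum_zmod (Additive (Abelianization G))
  rcases n with - | n
  · have : ∀ i, NeZero (p i ^ e i) := fun i => ⟨pow_ne_zero _ (hp i).ne_zero⟩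
    have : ∀ i, Finite (ZMod (p i ^ e i)) := inferInstance
    have : Finite (DirectSum ι fun i => ZMod (p i ^ e i)) :=
      Finite.of_equiv _ (DirectSum.addEquivProd _).symm.toEquiv
    exact Finite.of_equiv _ (f.toEquiv.symm.trans Additive.toMul)
  · exfalso
    let χ : G →* Multiplicative ℤ :=
      (AddMonoidHom.toMultiplicative
        (((Finsupp.applyAddHom (0 : Fin (n + 1))).comp (AddMonoidHom.fst _ _)).comp
          f.toAddMonoidHom)).comp Abelianization.of
    obtain ⟨g, hg⟩ : ∃ g, χ g = Multiplicative.ofAdd 1 := by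
      obtain ⟨g, hg⟩ := QuotientGroup.mk_surjective (f.symm (Finsupp.single 0 1, 0)).toMul
      refine ⟨g, ?_⟩
      change Multiplicative.ofAdd ((f (Additive.ofMul (Abelianization.of g))).1 0) = _
      rw [show Abelianization.of g = _ from hg]
      simp
    obtain ⟨R, hR, hRK⟩ := Subgroup.isFinitelyNormallyGenerated_of_quotient _ hE
    -- A single large $k$ kills a finite normal generating set, hence the whole normal closure,
    -- against `exists_shiftSwapHom_ne_one`.
    have h1 : ∀ᶠ k in atTop, ∀ r ∈ R, shiftSwapHom χ k r = 1 :=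
      (eventually_all_finite hR).2 fun r hr =>
        eventually_shiftSwapHom_eq_one χ (hRK ▸ Subgroup.subset_normalClosure hr)
    obtain ⟨k, hk, hk0⟩ := (h1.and (eventually_gt_atTop 0)).exists
    obtain ⟨x, hx, hx1⟩ := exists_shiftSwapHom_ne_one hg hk0
    refine hx1 ?_
    have h2 : Subgroup.normalClosure R ≤ (shiftSwapHom χ k).ker :=
      Subgroup.normalClosure_le_normal hk
    exact h2 (hRK ▸ Subgroup.subset_normalClosure hx)

end Abelianization

/-! ### The structure of $\mathcal E(G)$ relative to $G^3$. -/

namespace SidkiE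

open Monoid.Coprod
open scoped commutatorElement

variable (G : Type*) [Group G]

theorem normal_of_conj_mem {G : Type*} [Group G] {H : Subgroup (Monoid.Coprod G G)}
    (hl : ∀ g, ∀ x ∈ H, inl g * x * (inl g)⁻¹ ∈ H) (hr : ∀ g, ∀ x ∈ H, inr g * x * (inr g)⁻¹ ∈ H) :
    H.Normal := by
  refine ⟨fun x hx c => ?_⟩
  induction c using Monoid.Coprod.induction_on generalizing x with
  | inl g => exact hl g x hx
  | inr g => exact hr g x hx
  | mul c d hc hd =>
    have := hc _ (hd x hx)
    simpa [mul_assoc] using this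

instance normal_D : (D G).Normal := by
  have hmem : ∀ a b : G, ⁅(inl a : Monoid.Coprod G G), inr b⁆ ∈ D G := fun a b =>
    Subgroup.commutator_mem_commutator ⟨a, rfl⟩ ⟨b, rfl⟩
  have key : ∀ c : Monoid.Coprod G G,
      (∀ a b : G, c * ⁅(inl a : Monoid.Coprod G G), inr b⁆ * c⁻¹ ∈ D G) →
      ∀ x ∈ D G, c * x * c⁻¹ ∈ D G := by
    intro c hc
    have : D G ≤ (D G).comap (MulAut.conj c).toMonoidHom := by
      refine Subgroup.commutator_le.2 ?_
      rintro _ ⟨a, rfl⟩ _ ⟨b, rfl⟩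
      exact hc a b
    exact fun x hx => this hx
  refine normal_of_conj_mem (fun g => key _ fun a b => ?_) (fun g => key _ fun a b => ?_)
  · have h := mul_mem (hmem (g * a) b) (inv_mem (hmem g b))
    convert h using 1
    simp only [commutatorElement_def, map_mul]
    group
  · have h := mul_mem (inv_mem (hmem a g)) (hmem a (g * b))
    convert h using 1
    simp only [commutatorElement_def, map_mul]
    group

theorem ker_toProd : (toProd : Monoid.Coprod G G →* G × G).ker = D G := by
  refine le_antisymm (fun x hx => ?_) (Subgroup.commutator_le.2 ?_)
  · let q := QuotientGroup.mk' (D G)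
    have hq : ∀ a b : G, Commute (q (inl a)) (q (inr b)) := by
      intro a b
      rw [← commutatorElement_eq_one_iff_commute, ← map_commutatorElement, ← MonoidHom.mem_ker,
        QuotientGroup.ker_mk']
      exact Subgroup.commutator_mem_commutator ⟨a, rfl⟩ ⟨b, rfl⟩
    have h : ∀ x, q x = q (inl (fst x)) * q (inr (snd x)) := by
      intro x
      induction x using Monoid.Coprod.induction_on with
      | inl g => simp
      | inr g => simp
      | mul x y hx hy =>
        rw [map_mul, hx, hy]
        simp only [map_mul]
        rw [(hq _ _).symm.mul_mul_mul_comm]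
    rw [← QuotientGroup.ker_mk' (D G), MonoidHom.mem_ker]
    refine (h x).trans ?_
    have h1 : fst x = 1 := by rw [← fst_toProd, MonoidHom.mem_ker.1 hx]; rfl
    have h2 : snd x = 1 := by rw [← snd_toProd, MonoidHom.mem_ker.1 hx]; rfl
    simp [h1, h2]
  · rintro _ ⟨a, rfl⟩ _ ⟨b, rfl⟩
    rw [MonoidHom.mem_ker, map_commutatorElement, toProd_apply_inl, toProd_apply_inr]
    ext <;> simp [commutatorElement_def]

instance normal_L : (L G).Normal := by
  have hmem : ∀ a : G, (inl a)⁻¹ * inr a ∈ L G := fun a => Subgroup.subset_closure ⟨a, rfl⟩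
  have key : ∀ c : Monoid.Coprod G G, (∀ a : G, c * ((inl a)⁻¹ * inr a) * c⁻¹ ∈ L G) →
      ∀ x ∈ L G, c * x * c⁻¹ ∈ L G := by
    intro c hc
    have : L G ≤ (L G).comap (MulAut.conj c).toMonoidHom := by
      refine (Subgroup.closure_le _).2 ?_
      rintro _ ⟨a, rfl⟩
      exact hc a
    exact fun x hx => this hx
  refine normal_of_conj_mem (fun g => key _ fun a => ?_) (fun g => key _ fun a => ?_)
  · have h := mul_mem (hmem (a * g⁻¹)) (inv_mem (hmem g⁻¹))
    convert h using 1
    simp only [map_mul, map_inv]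
    group
  · have h := mul_mem (inv_mem (hmem g⁻¹)) (hmem (a * g⁻¹))
    convert h using 1
    simp only [map_mul, map_inv]
    group

theorem ker_lift_id_id : (lift (MonoidHom.id G) (MonoidHom.id G)).ker = L G := by
  refine le_antisymm (fun x hx => ?_) (L_le_ker_lift _)
  let q := QuotientGroup.mk' (L G)
  have h : q = (q.comp inl).comp (lift (MonoidHom.id G) (MonoidHom.id G)) := by
    refine Monoid.Coprod.hom_ext rfl (MonoidHom.ext fun g => ?_)
    change q (inr g) = q (inl g)
    rw [eq_comm, ← inv_mul_eq_one, ← map_inv, ← map_mul, ← MonoidHom.mem_ker,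
      QuotientGroup.ker_mk']
    exact Subgroup.subset_closure ⟨g, rfl⟩
  rw [← QuotientGroup.ker_mk' (L G), MonoidHom.mem_ker]
  refine (DFunLike.congr_fun h x).trans ?_
  rw [MonoidHom.comp_apply, MonoidHom.mem_ker.1 hx, map_one]

/-- The quotient map from `G ∗ Ḡ` onto `ℰ(G)`. -/
abbrev proj : Monoid.Coprod G G →* SidkiE G := QuotientGroup.mk' _

theorem proj_surjective : Function.Surjective (proj G) := QuotientGroup.mk'_surjective _

variable {G}

theorem commute_proj {d l : Monoid.Coprod G G} (hd : d ∈ D G) (hl : l ∈ L G) :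
    Commute (proj G d) (proj G l) := by
  rw [← commutatorElement_eq_one_iff_commute, ← map_commutatorElement, ← MonoidHom.mem_ker,
    QuotientGroup.ker_mk']
  exact Subgroup.subset_normalClosure (Subgroup.commutator_mem_commutator hd hl)

theorem normalClosure_le_ker {H : Type*} [Group H] {f : Monoid.Coprod G G →* H}
    (h : ∀ d ∈ D G, ∀ l ∈ L G, Commute (f d) (f l)) :
    Subgroup.normalClosure
      ((⁅D G, L G⁆ : Subgroup (Monoid.Coprod G G)) : Set (Monoid.Coprod G G)) ≤ f.ker := by
  refine Subgroup.normalClosure_le_normal (Subgroup.commutator_le.2 fun d hd l hl => ?_)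
  rw [MonoidHom.mem_ker, map_commutatorElement, commutatorElement_eq_one_iff_commute]
  exact h d hd l hl

theorem fst_eq_one {d : Monoid.Coprod G G} (hd : d ∈ D G) : fst d = 1 := by
  rw [← ker_toProd] at hd
  rw [← fst_toProd, MonoidHom.mem_ker.1 hd]; rfl

theorem snd_eq_one {d : Monoid.Coprod G G} (hd : d ∈ D G) : snd d = 1 := by
  rw [← ker_toProd] at hd
  rw [← snd_toProd, MonoidHom.mem_ker.1 hd]; rfl

variable (G)

/-- The retraction of `ℰ(G)` onto `G` that kills the second copy of `G`. -/
def toFst : SidkiE G →* G :=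
  QuotientGroup.lift _ fst (normalClosure_le_ker fun d hd l _ => by
    rw [fst_eq_one hd]; exact Commute.one_left _)

theorem toFst_proj (x : Monoid.Coprod G G) : toFst G (proj G x) = fst x := rfl

theorem toFst_surjective : Function.Surjective (toFst G) := fun g => ⟨proj G (inl g), rfl⟩

/-- The map from `G ∗ Ḡ` to `G × G × G` that sends `g` to `(g, 1, g)` and `ḡ` to `(1, g, g)`. -/
def toTripleAux : Monoid.Coprod G G →* (Fin 3 → G) :=
  MonoidHom.pi ![fst, snd, lift (MonoidHom.id G) (MonoidHom.id G)]

/-- The map from `ℰ(G)` to `G × G × G` that sends `g` to `(g, 1, g)` and `ḡ` to `(1, g, g)`. -/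
def toTriple : SidkiE G →* (Fin 3 → G) :=
  QuotientGroup.lift _ (toTripleAux G) (normalClosure_le_ker fun d hd l hl => by
    refine funext fun k => ?_
    fin_cases k
    · change fst d * fst l = fst l * fst d
      simp [fst_eq_one hd]
    · change snd d * snd l = snd l * snd d
      simp [snd_eq_one hd]
    · change lift (MonoidHom.id G) (MonoidHom.id G) d * lift (MonoidHom.id G) (MonoidHom.id G) l =
        lift (MonoidHom.id G) (MonoidHom.id G) l * lift (MonoidHom.id G) (MonoidHom.id G) d
      rw [← ker_lift_id_id] at hl
      simp [MonoidHom.mem_ker.1 hl])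

theorem toTriple_proj_zero (x : Monoid.Coprod G G) : toTriple G (proj G x) 0 = fst x := rfl

theorem toTriple_proj_one (x : Monoid.Coprod G G) : toTriple G (proj G x) 1 = snd x := rfl

theorem toTriple_proj_two (x : Monoid.Coprod G G) :
    toTriple G (proj G x) 2 = lift (MonoidHom.id G) (MonoidHom.id G) x := rfl

variable {G}

theorem exists_of_mem_ker_toTriple {e : SidkiE G} (he : e ∈ (toTriple G).ker) :
    ∃ x ∈ D G, x ∈ L G ∧ proj G x = e := by
  obtain ⟨x, rfl⟩ := proj_surjective G e
  refine ⟨x, ?_, ?_, rfl⟩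
  · rw [← ker_toProd, MonoidHom.mem_ker, ← prod_mk_fst_snd, ← toTriple_proj_zero,
      ← toTriple_proj_one, MonoidHom.mem_ker.1 he]
    rfl
  · rw [← ker_lift_id_id, MonoidHom.mem_ker, ← toTriple_proj_two, MonoidHom.mem_ker.1 he]
    rfl

/-- Kernel elements lift to $\mathcal D\cap\mathcal L$; one is viewed in $\mathcal D$, the other in
$\mathcal L$. -/
theorem commute_of_mem_ker_toTriple {e f : SidkiE G} (he : e ∈ (toTriple G).ker)
    (hf : f ∈ (toTriple G).ker) : Commute e f := by
  obtain ⟨x, hx, -, rfl⟩ := exists_of_mem_ker_toTriple he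
  obtain ⟨y, -, hy, rfl⟩ := exists_of_mem_ker_toTriple hf
  exact commute_proj hx hy

/-- The centralizer contains the images of $\mathcal D$ and $\mathcal L$. Modulo $\mathcal L$ the
two copies of $G$ coincide, and modulo $\mathcal D$ they commute, so the quotient is an image of
$G^{ab}$. -/
theorem finite_quotient_centralizer_ker_toTriple [Finite (Abelianization G)] :
    Finite (SidkiE G ⧸ Subgroup.centralizer ((toTriple G).ker : Set (SidkiE G))) := by
  let q := QuotientGroup.mk' (Subgroup.centralizer ((toTriple G).ker : Set (SidkiE G)))
  have hq : ∀ x, x ∈ D G ∨ x ∈ L G → q (proj G x) = 1 := by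
    intro x hx
    rw [← MonoidHom.mem_ker, QuotientGroup.ker_mk']
    refine Subgroup.mem_centralizer_iff.2 fun e he => ?_
    obtain ⟨y, hyD, hyL, rfl⟩ := exists_of_mem_ker_toTriple he
    rcases hx with hx | hx
    · exact (commute_proj hx hyL).symm.eq
    · exact (commute_proj hyD hx).eq
  have hlr : ∀ g, q (proj G (inl g)) = q (proj G (inr g)) := by
    intro g
    have := hq _ (.inr (Subgroup.subset_closure ⟨g, rfl⟩))
    rwa [map_mul, map_mul, map_inv, map_inv, inv_mul_eq_one] at this
  let ω : G →* _ := (q.comp (proj G)).comp inl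
  have hω : commutator G ≤ ω.ker := by
    refine Subgroup.commutator_le.2 fun g _ h _ => ?_
    have h1 : ω h = q (proj G (inr h)) := hlr h
    have h2 : ω g = q (proj G (inl g)) := rfl
    rw [MonoidHom.mem_ker, map_commutatorElement, h1, h2, ← map_commutatorElement,
      ← map_commutatorElement]
    exact hq _ (.inl (Subgroup.commutator_mem_commutator ⟨g, rfl⟩ ⟨h, rfl⟩))
  have hfac : q.comp (proj G) = ω.comp (lift (MonoidHom.id G) (MonoidHom.id G)) :=
    Monoid.Coprod.hom_ext rfl (MonoidHom.ext fun g => (hlr g).symm)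
  have : Finite (G ⧸ commutator G) := ‹Finite (Abelianization G)›
  refine Finite.of_surjective
    (QuotientGroup.lift (commutator G) ω hω : Abelianization G → _) fun y => ?_
  obtain ⟨e, rfl⟩ := QuotientGroup.mk'_surjective _ y
  obtain ⟨x, rfl⟩ := proj_surjective G e
  exact ⟨Abelianization.of (lift (MonoidHom.id G) (MonoidHom.id G) x),
    (DFunLike.congr_fun hfac x).symm⟩

theorem finite_conj_of_mem_ker_toTriple [Finite (Abelianization G)] {z : SidkiE G}
    (hz : z ∈ (toTriple G).ker) : (Set.range fun c : SidkiE G => c * z * c⁻¹).Finite := by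
  have := finite_quotient_centralizer_ker_toTriple (G := G)
  refine (Set.finite_range fun a : SidkiE G ⧸ Subgroup.centralizer
    ((toTriple G).ker : Set (SidkiE G)) => a.out * z * a.out⁻¹).subset ?_
  rintro _ ⟨c, rfl⟩
  refine ⟨(c : SidkiE G ⧸ Subgroup.centralizer ((toTriple G).ker : Set (SidkiE G))), ?_⟩
  beta_reduce
  generalize ho : (c : SidkiE G ⧸
    Subgroup.centralizer ((toTriple G).ker : Set (SidkiE G))).out = o
  have h : o⁻¹ * c ∈ Subgroup.centralizer ((toTriple G).ker : Set (SidkiE G)) := by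
    rw [← ho]
    exact QuotientGroup.eq.1 (Quotient.out_eq _)
  have h := Subgroup.mem_centralizer_iff.1 h z hz
  obtain ⟨u, rfl⟩ : ∃ u, c = o * u := ⟨o⁻¹ * c, by group⟩
  rw [inv_mul_cancel_left] at h
  have hu : u * z * u⁻¹ = z := by rw [← h, mul_inv_cancel_right]
  calc o * z * o⁻¹ = o * (u * z * u⁻¹) * o⁻¹ := by rw [hu]
    _ = _ := by group

/-- The element $[g,\overline h]$ maps to $(1,1,[g,h])$. The first two coordinates can be cleared by
$g\overline h$, so cosets are represented by third coordinates modulo $[G,G]$. -/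
theorem finiteIndex_range_toTriple [Finite (Abelianization G)] :
    (toTriple G).range.FiniteIndex := by
  let σ : G →* (Fin 3 → G) := MonoidHom.mulSingle (fun _ => G) 2
  have hσ : commutator G ≤ (toTriple G).range.comap σ := by
    refine Subgroup.commutator_le.2 fun g _ h _ => ⟨proj G ⁅(inl g : Monoid.Coprod G G), inr h⁆,
      funext fun k => ?_⟩
    fin_cases k
    · change fst ⁅(inl g : Monoid.Coprod G G), (inr h : Monoid.Coprod G G)⁆ = σ ⁅g, h⁆ 0
      simp [σ, commutatorElement_def]
    · change snd ⁅(inl g : Monoid.Coprod G G), (inr h : Monoid.Coprod G G)⁆ = σ ⁅g, h⁆ 1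
      simp [σ, commutatorElement_def]
    · change lift (MonoidHom.id G) (MonoidHom.id G)
        ⁅(inl g : Monoid.Coprod G G), (inr h : Monoid.Coprod G G)⁆ = σ ⁅g, h⁆ 2
      simp [σ, commutatorElement_def]
  have : Finite ((Fin 3 → G) ⧸ (toTriple G).range) := by
    refine Finite.of_surjective
      (fun a : Abelianization G => ((σ a.out : Fin 3 → G) : (Fin 3 → G) ⧸ (toTriple G).range))
      fun y => ?_
    obtain ⟨γ, rfl⟩ := QuotientGroup.mk_surjective y
    let x : G := γ 2 * (γ 0 * γ 1)⁻¹
    refine ⟨Abelianization.of x, ?_⟩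
    have h1 : ((σ (Abelianization.of x).out : Fin 3 → G) : (Fin 3 → G) ⧸ (toTriple G).range) =
        (σ x : Fin 3 → G) := by
      rw [QuotientGroup.eq, ← map_inv, ← map_mul]
      exact hσ (QuotientGroup.eq.1 (Quotient.out_eq (Abelianization.of x)))
    refine h1.trans ?_
    rw [QuotientGroup.eq]
    refine ⟨proj G (inl (γ 0) * inr (γ 1)), funext fun k => ?_⟩
    fin_cases k
    · change fst (inl (γ 0) * inr (γ 1)) = ((σ x)⁻¹ * γ) 0
      simp [σ]
    · change snd (inl (γ 0) * inr (γ 1)) = ((σ x)⁻¹ * γ) 1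
      simp [σ]
    · change lift (MonoidHom.id G) (MonoidHom.id G) (inl (γ 0) * inr (γ 1)) = ((σ x)⁻¹ * γ) 2
      simp [σ, x]
  exact Subgroup.finiteIndex_of_finite_quotient

theorem fg_of_isFinitelyPresented (hE : Group.IsFinitelyPresented (SidkiE G)) : Group.FG G := by
  obtain ⟨n, φ, hφ, -⟩ := hE.out
  exact Group.fg_of_surjective (f := (toFst G).comp φ) ((toFst_surjective G).comp hφ)

/-- $G$ is the quotient of $\mathcal E(G)$ by $\overline G$, and killing finitely many generators of
$\overline G$ suffices. -/
theorem isFinitelyPresented_of_isFinitelyPresented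
    (hE : Group.IsFinitelyPresented (SidkiE G)) : Group.IsFinitelyPresented G := by
  obtain ⟨S, hS⟩ := Group.fg_def.1 (fg_of_isFinitelyPresented hE)
  refine Group.IsFinitelyPresented.of_surjective (toFst G) (toFst_surjective G)
    ⟨(proj G).comp inr '' S, S.finite_toSet.image _, le_antisymm ?_ fun e he => ?_⟩
  · refine Subgroup.normalClosure_le_normal ?_
    rintro _ ⟨g, -, rfl⟩
    rw [SetLike.mem_coe, MonoidHom.mem_ker, MonoidHom.comp_apply, toFst_proj]
    simp
  · let q := QuotientGroup.mk' (Subgroup.normalClosure ((proj G).comp inr '' (S : Set G)))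
    have h1 : (q.comp (proj G)).comp inr = 1 := by
      refine MonoidHom.eq_of_eqOn_dense hS fun g hg => ?_
      rw [MonoidHom.comp_apply, MonoidHom.comp_apply, MonoidHom.one_apply, ← MonoidHom.mem_ker,
        QuotientGroup.ker_mk']
      exact Subgroup.subset_normalClosure ⟨g, hg, rfl⟩
    have h2 : q.comp (proj G) = ((q.comp (proj G)).comp inl).comp fst :=
      Monoid.Coprod.hom_ext rfl (h1.trans (MonoidHom.ext fun g => by
        simp only [MonoidHom.one_apply, MonoidHom.comp_apply, fst_apply_inr, map_one]))
    obtain ⟨x, rfl⟩ := proj_surjective G e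
    rw [MonoidHom.mem_ker, toFst_proj] at he
    rw [← QuotientGroup.ker_mk' (Subgroup.normalClosure ((proj G).comp inr '' (S : Set G))),
      MonoidHom.mem_ker]
    refine (DFunLike.congr_fun h2 x).trans ?_
    rw [MonoidHom.comp_apply, he, map_one]

end SidkiE

/-! ### The Dehn function estimate. -/

theorem propositionJ {G : Type*} [Group G] (hE : Group.IsFinitelyPresented (SidkiE G)) :
    Group.IsFinitelyPresented G ∧
      ∀ {X Y : Type*} (φ : FreeGroup X →* SidkiE G) (R : Set (FreeGroup X))
        (ψ : FreeGroup Y →* G) (S : Set (FreeGroup Y)),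
        IsFinitePresentation φ R → IsFinitePresentation ψ S →
          dehnFunction R ≼ᵈ fun n => max (n ^ 4) (dehnFunction S n ^ 2) := by
  classical
  refine ⟨SidkiE.isFinitelyPresented_of_isFinitelyPresented hE, ?_⟩
  intro X Y φ R ψ S hR hS
  have := SidkiE.fg_of_isFinitelyPresented hE
  have := SidkiE.finite_abelianization hE
  have := hR.finite_generators
  have := hS.finite_generators
  let η : FreeGroup X →* (Fin 3 → G) := (SidkiE.toTriple G).comp φ
  have hη : η.range.FiniteIndex := by
    rw [MonoidHom.range_comp, MonoidHom.range_eq_top.2 hR.surjective, ← MonoidHom.range_eq_map]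
    exact SidkiE.finiteIndex_range_toTriple
  have hSker : S ⊆ ψ.ker := hS.normalClosure_eq_ker ▸ Subgroup.subset_normalClosure
  obtain ⟨T, hT, hTη, κ, C, hκ, hκn, hκA⟩ := exists_transfer_of_finiteIndex η (tripleHom ψ)
    (tripleHom_surjective hS.surjective) (tripleRelators_finite hS.finite_relators)
    (tripleRelators_subset_ker hSker)
  have hmem : ∀ r ∈ T ∪ T⁻¹, φ r ∈ (SidkiE.toTriple G).ker := by
    rintro r (hr | hr)
    · exact hTη hr
    · have := hTη hr
      rwa [SetLike.mem_coe, inv_mem_iff] at this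
  -- All conjugates in $\mathcal E(G)$ of the rewritten relators: a finite, conjugation-invariant
  -- set of commuting elements, whose lifts are the words $\zeta$.
  let Z : Set (SidkiE G) := ⋃ r ∈ T ∪ T⁻¹, Set.range fun c => c * φ r * c⁻¹
  have hZfin : Z.Finite := (hT.union hT.inv).biUnion fun r hr =>
    SidkiE.finite_conj_of_mem_ker_toTriple (hmem r hr)
  have hZker : ∀ z ∈ Z, z ∈ (SidkiE.toTriple G).ker := by
    intro z hz
    obtain ⟨r, hr, c, rfl⟩ := Set.mem_iUnion₂.1 hz
    exact (inferInstance : (SidkiE.toTriple G).ker.Normal).conj_mem _ (hmem r hr) c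
  have := hZfin.to_subtype
  choose ζ hζ using fun z : Z => hR.surjective z.1
  obtain ⟨C', hC'⟩ := exists_areaLE_of_conj_closed (R := R) (ζ := ζ) (T := T)
    (by
      intro i j
      rw [hR.normalClosure_eq_ker, MonoidHom.mem_ker, map_mul, map_inv, mul_inv_eq_one, map_mul,
        map_mul, hζ, hζ]
      exact SidkiE.commute_of_mem_ker_toTriple (hZker _ j.2) (hZker _ i.2))
    (by
      intro θ i
      obtain ⟨r, hr, c, hc⟩ := Set.mem_iUnion₂.1 i.2
      refine ⟨⟨(φ θ)⁻¹ * i.1 * φ θ, Set.mem_iUnion₂.2 ⟨r, hr, (φ θ)⁻¹ * c, ?_⟩⟩, ?_⟩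
      · rw [← hc]; group
      · rw [hR.normalClosure_eq_ker, MonoidHom.mem_ker, map_mul, map_inv, mul_inv_eq_one, hζ,
          map_mul, map_mul, map_inv, hζ])
    hT
    (by
      intro r hr
      refine ⟨⟨φ r, Set.mem_iUnion₂.2 ⟨r, hr, 1, by simp⟩⟩, ?_⟩
      rw [hR.normalClosure_eq_ker, MonoidHom.mem_ker, map_mul, map_inv, mul_inv_eq_one, hζ])
  -- With $A\le 6CM$, the bound $C'A(A+1)\le 2C'A^2$ gives $72C'C^2M^2$. The summand $C+1$ ensures
  -- that $N$ dominates both $C|w|$ and $|w|+1$.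
  refine ⟨72 * C' * C ^ 2 + C + 1, by omega, fun n => ?_⟩
  obtain ⟨w, hw, hn, hw'⟩ := (isGreatest_dehnFunction R n).1
  rw [← hw']
  have hn : w.norm ≤ n := by convert hn
  set N := (72 * C' * C ^ 2 + C + 1) * n + (72 * C' * C ^ 2 + C + 1) with hN
  have hN1 : C * w.norm ≤ N := by nlinarith [Nat.zero_le (C' * C ^ 2 * n)]
  have hN2 : w.norm + 1 ≤ N := by nlinarith [Nat.zero_le (C' * C ^ 2 * n), Nat.zero_le (C * n)]
  have hwker : κ w ∈ (tripleHom ψ).ker := by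
    have h1 : tripleHom ψ (κ w) = η w := DFunLike.congr_fun hκ w
    rw [hR.normalClosure_eq_ker, MonoidHom.mem_ker] at hw
    rw [MonoidHom.mem_ker, h1, MonoidHom.comp_apply, hw, map_one]
  obtain ⟨l, hl, hlen, hln⟩ := hκA w _
    (areaLE_tripleRelators hS.normalClosure_eq_ker hwker ((hκn w).trans hN1))
  refine (hC' w hw l _ hl hlen hln).relatorArea_le.trans ?_
  set δ := dehnFunction S N
  set M := max (N ^ 2) δ with hM
  have hM2 : M ^ 2 = max (N ^ 4) (δ ^ 2) := by
    rw [hM, (pow_left_mono 2).map_max, ← pow_mul]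
  set A := C * (2 * N ^ 2 + 3 * δ + w.norm + 1) with hA
  have hAM : A ≤ 6 * C * M := by
    have h1 : N ^ 2 ≤ M := le_max_left _ _
    have h2 : δ ≤ M := le_max_right _ _
    have h3 : N ≤ N ^ 2 := Nat.le_self_pow two_ne_zero N
    calc A ≤ C * (6 * M) := Nat.mul_le_mul_left _ (by omega)
      _ = 6 * C * M := by ring
  calc C' * A * (A + 1) ≤ C' * (2 * A ^ 2) := by
        rw [mul_assoc]
        refine Nat.mul_le_mul_left _ ?_
        have := Nat.le_self_pow two_ne_zero A
        nlinarith
    _ ≤ C' * (2 * (6 * C * M) ^ 2) := by gcongr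
    _ = 72 * C' * C ^ 2 * M ^ 2 := by ring
    _ ≤ (72 * C' * C ^ 2 + C + 1) * M ^ 2 := Nat.mul_le_mul_right _ (by omega)
    _ ≤ _ := by
        rw [hM2]
        exact (Nat.le_add_right _ _).trans (Nat.le_add_right _ _)
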